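/- **Setting.** Let $\mathcal H$ be a real Hilbert space of finite or countably infinite dimension $D$, and let $(x,y)\sim\mathcal D$ take values in $\mathcal H\times\mathbb R$. Put $L(w)=\tfrac12\mathbb E\,(y-\langle w,x\rangle)^2$ and $H=\mathbb E[xx^\top]$. Assume: (a) $\mathbb E\|x\|^2=\operatorname{tr}(H)$, $\mathbb E\|x\|^4$ and $\mathbb E[y^2]$ are finite, $H$ is strictly positive definite, and $L$ has a unique global minimizer $w^*$; (b) for some $\alpha>0$, $\mathbb E[xx^\top Axx^\top]\preceq\alpha\operatorname{tr}(HA)H$ for every positive semidefinite bounded operator $A$ on $\mathcal H$; (c) $\Sigma=\mathbb E[(y-\langle w^*,x\rangle)^2xx^\top]$ exists and $\|H^{-1/2}\Sigma H^{-1/2}\|_2\le\sigma^2<\infty$. Let $w_t=w_{t-1}+\gamma\,(y_t-\langle w_{t-1},x_t\rangle)\,x_t$ for $t\ge1$ be the SGD iterates on i.i.d. samples $(x_t,y_t)\sim\mathcal D$, started at a deterministic $w_0\in\mathcal H$ with constant stepsize $0<\gamma\le 1/(\alpha\operatorname{tr}(H))$, and let $\overline w_N=\frac1N\sum_{t=0}^{N-1}w_t$.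 Assume $\|w_0-w^*\|\le\rho$. **Corollary (example data distributions).** Fix $\alpha,\gamma>0$, $\sigma^2$ and $\rho$. In each case below there is a constant $C$, depending only on $\alpha,\gamma,\sigma^2,\rho$ and on the parameters ($r,q$, resp. $r$, resp. $\beta$) of the spectrum, such that for every $N\ge2$ and every problem as above whose covariance $H$ has the indicated eigenvalues $\lambda_k$ ($1\le k\le D$, counted with multiplicity), $\mathbb E[L(\overline w_N)]$ is finite and $\mathbb E[L(\overline w_N)]-L(w^*)\le C\,\varepsilon_N$. 1. Let $0<r\le1\le q$, let $s,d$ be natural numbers equal to $N^r$ and $N^q$ up to rounding, that is, $|s-N^r|<1$ and $|d-N^q|<1$, let $D=d$, and let $\lambda_k=1/s$ for $k\le s$ and $\lambda_k=1/(d-s)$ for $s<k\le d$. Then $\varepsilon_N=N^{r-1}+N^{1-q}$. 2. If $\lambda_k=k^{-(1+r)}$ with $r>0$, then $\varepsilon_N=N^{-r/(1+r)}$. 3. If $\lambda_k=k^{-1}\log^{-\beta}(k+1)$ with $\beta>1$, then $\varepsilon_N=\log^{-\beta}N$. 4. If $\lambda_k=e^{-k}$, then $\varepsilon_N=\log N/N$.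 In 2–4 the dimension $D$ may be finite or infinite, and $C$ does not depend on it. -/

import Mathlib

open MeasureTheory ProbabilityTheory

universe u v

noncomputable section

namespace BenignSGD

/-- Index set `{1, …, D}` of the eigenvalues in dimension `D`; for `D = ⊤` it is `{1, 2, 3, …}`. -/
abbrev Idx (D : ℕ∞) : Type := {k : ℕ // 1 ≤ k ∧ (k : ℕ∞) ≤ D}

section Problem

variable {E : Type u} [NormedAddCommGroup E] [InnerProductSpace ℝ E]

/-- `x xᵀ`, the operator `v ↦ ⟪x, v⟫ x`. -/
def outer (x : E) : E →L[ℝ] E := InnerProductSpace.rankOne ℝ x x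

/-- Trace of an operator, computed in the orthonormal basis `b`. -/
def trace {ι : Type} (b : HilbertBasis ι ℝ E) (T : E →L[ℝ] E) : ℝ :=
  ∑' i, inner ℝ (b i) (T (b i))

/-- `S` is the bounded operator `H^{-1/2} Sig H^{-1/2}`, that is, `Sig = H^{1/2} S H^{1/2}`, where
`R = H^{1/2}` is the positive square root of `H`. For `H` strictly positive definite there is at
most one such `S`. -/
def IsInvSqrtConj (H Sig S : E →L[ℝ] E) : Prop :=
  ∃ R : E →L[ℝ] E, R.IsPositive ∧ R ∘L R = H ∧ R ∘L S ∘L R = Sig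

/-- SGD iterates with constant stepsize `γ`, started at `w₀`, on the samples
`z 1, z 2, …`, where `z t = (x_t, y_t)`:
`w_t = w_{t-1} + γ (y_t - ⟪w_{t-1}, x_t⟫) x_t`. -/
def sgd (γ : ℝ) (w₀ : E) (z : ℕ → E × ℝ) : ℕ → E
  | 0 => w₀
  | t + 1 => sgd γ w₀ z t +
      (γ * ((z (t + 1)).2 - inner ℝ (sgd γ w₀ z t) (z (t + 1)).1)) • (z (t + 1)).1

/-- The averaged iterate `(1/N) ∑_{t=0}^{N-1} w_t`. -/
def sgdAvg (γ : ℝ) (w₀ : E) (z : ℕ → E × ℝ) (N : ℕ) : E :=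
  (N : ℝ)⁻¹ • ∑ t ∈ Finset.range N, sgd γ w₀ z t

variable [MeasurableSpace E]

/-- The population risk `L(w) = ½ E (y - ⟪w, x⟫)²`. -/
def risk (P : Measure (E × ℝ)) (w : E) : ℝ :=
  (1 / 2) * ∫ z, (z.2 - inner ℝ w z.1) ^ 2 ∂P

/-- `H = E[x xᵀ]`. -/
def secondMoment (P : Measure (E × ℝ)) : E →L[ℝ] E :=
  ∫ z, outer z.1 ∂P

/-- `E[x xᵀ A x xᵀ]`. -/
def fourthMoment (P : Measure (E × ℝ)) (A : E →L[ℝ] E) : E →L[ℝ] E :=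
  ∫ z, outer z.1 ∘L A ∘L outer z.1 ∂P

/-- `E[(y - ⟪w, x⟫)² x xᵀ]`. -/
def noiseCov (P : Measure (E × ℝ)) (w : E) : E →L[ℝ] E :=
  ∫ z, (z.2 - inner ℝ w z.1) ^ 2 • outer z.1 ∂P

/-- The standing assumptions on the law `P` of `(x, y)`, with `wstar` the minimizer of the risk,
`α` the fourth moment constant and `σsq` an upper bound for the noise level
`σ² = ‖H^{-1/2} Σ H^{-1/2}‖`. The orthonormal basis `b` only serves to compute traces. -/
structure Regular {ι : Type} (b : HilbertBasis ι ℝ E) (P : Measure (E × ℝ)) (wstar : E)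
    (α σsq : ℝ) : Prop where
  /-- `E[x xᵀ]` exists and has finite trace `E ‖x‖²`. -/
  second : Integrable (fun z : E × ℝ => ‖z.1‖ ^ 2) P
  /-- `E[x ⊗ x ⊗ x ⊗ x]` exists and is finite. -/
  fourth : Integrable (fun z : E × ℝ => ‖z.1‖ ^ 4) P
  response : Integrable (fun z : E × ℝ => z.2 ^ 2) P
  posDef : ∀ w : E, w ≠ 0 → 0 < inner ℝ w (secondMoment P w)
  minimizer : ∀ w : E, w ≠ wstar → risk P wstar < risk P w
  /-- `E[x xᵀ A x xᵀ] ≼ α tr(H A) H` for every positive semidefinite `A`. -/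
  fourth_le : ∀ A : E →L[ℝ] E, A.IsPositive →
    fourthMoment P A ≤ (α * trace b (secondMoment P ∘L A)) • secondMoment P
  /-- The gradient noise covariance at `wstar` exists. -/
  noise_exists :
    Integrable (fun z : E × ℝ => (z.2 - inner ℝ wstar z.1) ^ 2 • outer z.1) P
  /-- `‖H^{-1/2} Σ H^{-1/2}‖` exists and is at most `σsq`. -/
  noise_le : ∃ S : E →L[ℝ] E,
    IsInvSqrtConj (secondMoment P) (noiseCov P wstar) S ∧ ‖S‖ ≤ σsq

end Problem

/-- For every linear regression problem in a real Hilbert space of dimension `D` (finite or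
countably infinite) whose covariance operator has the eigenvalues `lam k`, `1 ≤ k ≤ D`, counted
with multiplicity, with fourth moment constant `α`, noise level at most `σsq`, admissible stepsize
`γ`, and `‖w₀ - w*‖ ≤ ρ`, the expected risk of averaged SGD run on `N` i.i.d. samples is finite and
the expected excess risk is at most `B`. -/
def ExcessRiskLE (α γ σsq ρ : ℝ) (N : ℕ) (D : ℕ∞) (lam : ℕ → ℝ) (B : ℝ) : Prop :=
  ∀ (E : Type u) [NormedAddCommGroup E] [InnerProductSpace ℝ E] [CompleteSpace E]
    [SecondCountableTopology E] [MeasurableSpace E] [BorelSpace E]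
    (P : Measure (E × ℝ)) [IsProbabilityMeasure P]
    (b : HilbertBasis (Idx D) ℝ E) (wstar w₀ : E)
    (Ω : Type v) [MeasurableSpace Ω] (μ : Measure Ω) [IsProbabilityMeasure μ]
    (Z : ℕ → Ω → E × ℝ),
    Regular b P wstar α σsq →
    (∀ k : Idx D, secondMoment P (b k) = lam k • b k) →
    γ ≤ 1 / (α * trace b (secondMoment P)) →
    ‖w₀ - wstar‖ ≤ ρ →
    iIndepFun Z μ → (∀ t, HasLaw (Z t) P μ) →
    Integrable (fun ω => risk P (sgdAvg γ w₀ (fun t => Z t ω) N)) μ ∧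
      ∫ ω, risk P (sgdAvg γ w₀ (fun t => Z t ω) N) ∂μ - risk P wstar ≤ B

/-- The two-level spectrum: `1/s` for `k ≤ s` and `1/(d-s)` for `s < k ≤ d`. -/
def twoLevel (s d : ℕ) (k : ℕ) : ℝ :=
  if k ≤ s then 1 / (s : ℝ) else 1 / ((d : ℝ) - (s : ℝ))

end BenignSGD

end

noncomputable section

namespace BenignSGD

set_option linter.unusedSectionVars false

/-! ### Moment inequalities and the first-order condition at the minimizer. -/

section Moments

variable {E : Type*} [NormedAddCommGroup E] [InnerProductSpace ℝ E]

/-! The excess risk is the quadratic form ½⟨w - w*, H(w - w*)⟩. By linearity w_t - w* splits into a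
bias part, the product of the random operators I - γxxᵀ applied to w₀ - w*, and a noise part, which
starts at 0 and is driven by the residuals at w*.

Bias. Hypothesis (b) with A = I and the stepsize condition give E‖x‖²⟨x,u⟩² ≤ γ⁻¹⟨u,Hu⟩, hence E‖(I
- γxxᵀ)u‖² ≤ ‖u‖² - γ⟨u,Hu⟩. The decrements telescope over time, and convexity of the quadratic form
bounds the averaged bias by ρ²/(γN) (`MomentBounds.integral_avg_biasSeq_le`).

Noise. The iterates are centred, and their covariance never exceeds γσ²I. Along a unit eigenvector
with eigenvalue λ their variance at time t is also at most 2tγ²σ²λ, and correlations at lag k carry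
the factor (1 - γλ)^k. Summing these correlations, with the first variance bound when Nγλ ≥ 1 and
the second when Nγλ ≤ 1, shows that the direction contributes at most (4σ²/N) min(1, Nγλ)²
(`MomentBounds.integral_inner_avg_noiseSeq_sq_le`).

Parseval then yields the excess risk bound ρ²/(γN) + (4σ²/N) ∑ min(1, Nγλ_k)²
(`Regular.excessRisk_le`). The sum is an effective dimension. For each spectrum it is cut at an
index K: each term of the head is at most 1, and the tail is bounded through (Nγλ_k)², or through
Nγλ_k for a short second level. -/

lemma outer_apply (x v : E) : outer x v = inner ℝ x v • x := rfl

lemma norm_outer (x : E) : ‖outer x‖ = ‖x‖ ^ 2 := by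
  rw [outer, InnerProductSpace.norm_rankOne, sq]

lemma continuous_outer : Continuous (outer : E → E →L[ℝ] E) := by
  have h : outer = fun x : E => ContinuousLinearMap.toSpanSingleton ℝ x ∘L innerSL ℝ x := by
    ext x v
    simp [outer_apply]
  rw [h]
  exact (ContinuousLinearMap.toSpanSingletonCLE (𝕜 := ℝ) (E := E)).continuous.clm_comp
    (innerSL ℝ).continuous

variable [CompleteSpace E] [SecondCountableTopology E] [MeasurableSpace E] [BorelSpace E]
  {P : Measure (E × ℝ)}

lemma integrable_outer (h : Integrable (fun z : E × ℝ => ‖z.1‖ ^ 2) P) :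
    Integrable (fun z : E × ℝ => outer z.1) P := by
  refine h.mono' (continuous_outer.comp continuous_fst).aestronglyMeasurable ?_
  exact Filter.Eventually.of_forall fun z => (norm_outer z.1).le

lemma secondMoment_apply (h : Integrable (fun z : E × ℝ => ‖z.1‖ ^ 2) P) (u w : E) :
    inner ℝ u (secondMoment P w) = ∫ z, inner ℝ z.1 u * inner ℝ z.1 w ∂P := by
  have hi := integrable_outer h
  rw [secondMoment, ContinuousLinearMap.integral_apply hi, ← integral_inner
    (hi.apply_continuousLinearMap w)]
  refine integral_congr_ae (Filter.Eventually.of_forall fun z => ?_)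
  simp only [outer_apply, inner_smul_right, real_inner_comm u z.1]
  ring

lemma integrable_inner_mul_inner (h : Integrable (fun z : E × ℝ => ‖z.1‖ ^ 2) P) (u w : E) :
    Integrable (fun z : E × ℝ => inner ℝ z.1 u * inner ℝ z.1 w) P := by
  refine (h.mul_const (‖u‖ * ‖w‖)).mono' (by fun_prop) (Filter.Eventually.of_forall fun z => ?_)
  rw [norm_mul]
  calc _ ≤ (‖z.1‖ * ‖u‖) * (‖z.1‖ * ‖w‖) := by
        gcongr <;> exact norm_inner_le_norm _ _
    _ = _ := by ring

lemma integrable_inner_sq (h : Integrable (fun z : E × ℝ => ‖z.1‖ ^ 2) P) (u : E) :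
    Integrable (fun z : E × ℝ => inner ℝ z.1 u ^ 2) P := by
  simpa only [sq] using integrable_inner_mul_inner h u u

lemma secondMoment_self (h : Integrable (fun z : E × ℝ => ‖z.1‖ ^ 2) P) (u : E) :
    inner ℝ u (secondMoment P u) = ∫ z, inner ℝ z.1 u ^ 2 ∂P := by
  simp only [secondMoment_apply h, sq]

lemma secondMoment_self_nonneg (h : Integrable (fun z : E × ℝ => ‖z.1‖ ^ 2) P) (u : E) :
    0 ≤ inner ℝ u (secondMoment P u) := by
  rw [secondMoment_self h]
  exact integral_nonneg fun z => sq_nonneg _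

lemma secondMoment_symm (h : Integrable (fun z : E × ℝ => ‖z.1‖ ^ 2) P) (u w : E) :
    inner ℝ (secondMoment P u) w = inner ℝ u (secondMoment P w) := by
  rw [real_inner_comm, secondMoment_apply h, secondMoment_apply h]
  simp only [mul_comm]

/-- The moment conditions on the law `P` that control the iterates of SGD with stepsize `γ`. -/
structure MomentBounds (P : Measure (E × ℝ)) (wstar : E) (γ σsq : ℝ) : Prop where
  second : Integrable (fun z : E × ℝ => ‖z.1‖ ^ 2) P
  fourth : Integrable (fun z : E × ℝ => ‖z.1‖ ^ 4) P
  noise : Integrable (fun z : E × ℝ => (z.2 - inner ℝ wstar z.1) ^ 2 * ‖z.1‖ ^ 2) P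
  fourth_le : ∀ u : E, ∫ z, ‖z.1‖ ^ 2 * inner ℝ z.1 u ^ 2 ∂P ≤ γ⁻¹ * inner ℝ u (secondMoment P u)
  noise_le : ∀ u : E, ∫ z, ((z.2 - inner ℝ wstar z.1) * inner ℝ z.1 u) ^ 2 ∂P ≤
    σsq * inner ℝ u (secondMoment P u)
  noise_mean : ∀ u : E, ∫ z, (z.2 - inner ℝ wstar z.1) * inner ℝ z.1 u ∂P = 0

variable {ι : Type} {b : HilbertBasis ι ℝ E} {wstar : E} {α σsq γ : ℝ}

lemma integrable_fourth_inner (h : Integrable (fun z : E × ℝ => ‖z.1‖ ^ 4) P) (u : E) :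
    Integrable (fun z : E × ℝ => ‖z.1‖ ^ 2 * inner ℝ z.1 u ^ 2) P := by
  refine (h.mul_const (‖u‖ ^ 2)).mono' (by fun_prop) (Filter.Eventually.of_forall fun z => ?_)
  rw [Real.norm_of_nonneg (by positivity)]
  have : inner ℝ z.1 u ^ 2 ≤ (‖z.1‖ * ‖u‖) ^ 2 := by
    rw [← sq_abs]
    gcongr
    exact abs_real_inner_le_norm _ _
  nlinarith [sq_nonneg ‖z.1‖]

/-- Since xxᵀxxᵀ = ‖x‖²xxᵀ, the choice A = I turns the fourth moment hypothesis into a scalar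
inequality for each direction. -/
lemma fourthMoment_id (h : Integrable (fun z : E × ℝ => ‖z.1‖ ^ 4) P) (u : E) :
    inner ℝ u (fourthMoment P (ContinuousLinearMap.id ℝ E) u) =
      ∫ z, ‖z.1‖ ^ 2 * inner ℝ z.1 u ^ 2 ∂P := by
  have hi : Integrable (fun z : E × ℝ =>
      outer z.1 ∘L ContinuousLinearMap.id ℝ E ∘L outer z.1) P := by
    refine h.mono' ?_ (Filter.Eventually.of_forall fun z => ?_)
    · have := (continuous_outer (E := E)).comp (continuous_fst (X := E) (Y := ℝ))
      exact (this.clm_comp (continuous_const.clm_comp this)).aestronglyMeasurable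
    · refine (ContinuousLinearMap.opNorm_comp_le _ _).trans ?_
      rw [ContinuousLinearMap.id_comp, norm_outer]
      exact le_of_eq (by ring)
  rw [fourthMoment, ContinuousLinearMap.integral_apply hi, ← integral_inner
    (hi.apply_continuousLinearMap u)]
  refine integral_congr_ae (Filter.Eventually.of_forall fun z => ?_)
  simp only [ContinuousLinearMap.comp_apply, ContinuousLinearMap.id_apply, outer_apply,
    inner_smul_right, real_inner_comm u z.1, real_inner_self_eq_norm_sq]
  ring

lemma inner_noiseCov (h : Integrable (fun z : E × ℝ =>
      (z.2 - inner ℝ wstar z.1) ^ 2 • outer z.1) P) (u : E) :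
    inner ℝ u (noiseCov P wstar u) =
      ∫ z, ((z.2 - inner ℝ wstar z.1) * inner ℝ z.1 u) ^ 2 ∂P := by
  rw [noiseCov, ContinuousLinearMap.integral_apply h, ← integral_inner
    (h.apply_continuousLinearMap u)]
  refine integral_congr_ae (Filter.Eventually.of_forall fun z => ?_)
  simp only [smul_apply, outer_apply,
    inner_smul_right, real_inner_comm u z.1]
  ring

/-- As R is self-adjoint, ⟨u, RSRu⟩ = ⟨Ru, SRu⟩ ≤ c‖Ru‖² = c⟨u, R²u⟩. -/
lemma IsInvSqrtConj.inner_le {H Sig S : E →L[ℝ] E} (h : IsInvSqrtConj H Sig S) {c : ℝ}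
    (hc : ‖S‖ ≤ c) (u : E) : inner ℝ u (Sig u) ≤ c * inner ℝ u (H u) := by
  obtain ⟨R, hR, rfl, rfl⟩ := h
  have hs : ∀ x y, inner ℝ (R x) y = inner ℝ x (R y) := fun x y => hR.1 x y
  simp only [ContinuousLinearMap.comp_apply]
  rw [← hs, ← hs, real_inner_self_eq_norm_sq]
  calc inner ℝ (R u) (S (R u)) ≤ ‖R u‖ * ‖S (R u)‖ := real_inner_le_norm _ _
    _ ≤ ‖R u‖ * (c * ‖R u‖) := by
        gcongr
        exact S.le_of_opNorm_le hc _
    _ = _ := by ring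

lemma integrable_residual_sq (hx : Integrable (fun z : E × ℝ => ‖z.1‖ ^ 2) P)
    (hy : Integrable (fun z : E × ℝ => z.2 ^ 2) P) (w : E) :
    Integrable (fun z : E × ℝ => (z.2 - inner ℝ w z.1) ^ 2) P := by
  refine ((hy.const_mul 2).add ((integrable_inner_sq hx w).const_mul 2)).mono' (by fun_prop)
    (Filter.Eventually.of_forall fun z => ?_)
  rw [Real.norm_of_nonneg (by positivity), Pi.add_apply, real_inner_comm z.1 w]
  nlinarith [sq_nonneg (z.2 + inner ℝ z.1 w)]

lemma integrable_residual_mul_inner (hx : Integrable (fun z : E × ℝ => ‖z.1‖ ^ 2) P)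
    (hy : Integrable (fun z : E × ℝ => z.2 ^ 2) P) (w u : E) :
    Integrable (fun z : E × ℝ => (z.2 - inner ℝ w z.1) * inner ℝ z.1 u) P := by
  refine ((integrable_residual_sq hx hy w).add (integrable_inner_sq hx u)).mono' (by fun_prop)
    (Filter.Eventually.of_forall fun z => ?_)
  rw [Real.norm_eq_abs, Pi.add_apply, abs_le]
  constructor <;>
  nlinarith [sq_nonneg (z.2 - inner ℝ w z.1 + inner ℝ z.1 u),
    sq_nonneg (z.2 - inner ℝ w z.1 - inner ℝ z.1 u), sq_nonneg (z.2 - inner ℝ w z.1),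
    sq_nonneg (inner ℝ z.1 u)]

lemma risk_add (hx : Integrable (fun z : E × ℝ => ‖z.1‖ ^ 2) P)
    (hy : Integrable (fun z : E × ℝ => z.2 ^ 2) P) (w u : E) :
    risk P (w + u) = risk P w - ∫ z, (z.2 - inner ℝ w z.1) * inner ℝ z.1 u ∂P +
      (1 / 2) * inner ℝ u (secondMoment P u) := by
  have h1 := integrable_residual_sq hx hy w
  have h2 := integrable_residual_mul_inner hx hy w u
  have h3 := integrable_inner_sq hx u
  have : ∀ z : E × ℝ, (z.2 - inner ℝ (w + u) z.1) ^ 2 = ((z.2 - inner ℝ w z.1) ^ 2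
      - 2 * ((z.2 - inner ℝ w z.1) * inner ℝ z.1 u)) + inner ℝ z.1 u ^ 2 := fun z => by
    rw [inner_add_left, real_inner_comm z.1 u]
    ring
  have h4 : Integrable (fun z : E × ℝ => (z.2 - inner ℝ w z.1) ^ 2
      - 2 * ((z.2 - inner ℝ w z.1) * inner ℝ z.1 u)) P := h1.sub (h2.const_mul 2)
  simp only [risk, this]
  rw [integral_add h4 h3, integral_sub h1 (h2.const_mul 2),
    integral_const_mul, secondMoment_self hx]
  ring

/-- First-order optimality: along every line through `wstar` the risk is a quadratic polynomial
minimal at 0, so its linear coefficient vanishes. This centres the gradient noise. -/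
lemma integral_residual_eq_zero (hx : Integrable (fun z : E × ℝ => ‖z.1‖ ^ 2) P)
    (hy : Integrable (fun z : E × ℝ => z.2 ^ 2) P)
    (hmin : ∀ w, risk P wstar ≤ risk P w) (u : E) :
    ∫ z, (z.2 - inner ℝ wstar z.1) * inner ℝ z.1 u ∂P = 0 := by
  set m := ∫ z, (z.2 - inner ℝ wstar z.1) * inner ℝ z.1 u ∂P with hm
  set q := inner ℝ u (secondMoment P u) with hq
  have hq0 : 0 ≤ q := secondMoment_self_nonneg hx u
  have key : ∀ t : ℝ, t * m ≤ t ^ 2 * q := fun t => by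
    have h0 := hmin (wstar + t • u)
    have h1 := secondMoment_self_nonneg hx (t • u)
    rw [risk_add hx hy] at h0
    simp only [inner_smul_right, map_smul, inner_smul_left, RCLike.conj_to_real,
      mul_left_comm _ t, integral_const_mul, ← hm, ← hq] at h0 h1
    nlinarith
  -- The natural test point `m / q` is unavailable when `q = 0`; with `q + 1` the quadratic term is
  -- still strictly smaller than the linear one unless `m = 0`.
  have h1 := key (m / (q + 1))
  by_contra hne
  have hpos : 0 < m ^ 2 := by positivity
  have hlt : (m / (q + 1)) ^ 2 * q < m / (q + 1) * m := by
    rw [div_pow, div_mul_eq_mul_div, div_mul_eq_mul_div, div_lt_div_iff₀ (by positivity)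
      (by positivity)]
    nlinarith [mul_pos hpos (by positivity : 0 < q + 1)]
  linarith

lemma Regular.risk_le (h : Regular b P wstar α σsq) (w : E) : risk P wstar ≤ risk P w := by
  by_cases hw : w = wstar
  · rw [hw]
  · exact (h.minimizer w hw).le

lemma Regular.risk_sub (h : Regular b P wstar α σsq) (w : E) :
    risk P w - risk P wstar =
      (1 / 2) * inner ℝ (w - wstar) (secondMoment P (w - wstar)) := by
  have := risk_add h.second h.response wstar (w - wstar)
  rw [integral_residual_eq_zero h.second h.response h.risk_le, add_sub_cancel] at this
  rw [this]
  ring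

/-- A nonpositive trace, including the default value 0 of a divergent sum, would make `1 / (α *
trace)` nonpositive (`1 / 0 = 0`), leaving no room for `0 < γ`. -/
lemma Regular.trace_pos (hα : 0 < α) (hγ : 0 < γ)
    (hγle : γ ≤ 1 / (α * trace b (secondMoment P))) : 0 < trace b (secondMoment P) := by
  have h := one_div_pos.1 (hγ.trans_le hγle)
  exact (mul_pos_iff_of_pos_left hα).1 h

lemma Regular.momentBounds (h : Regular b P wstar α σsq) (hα : 0 < α) (hγ : 0 < γ)
    (hγle : γ ≤ 1 / (α * trace b (secondMoment P))) : MomentBounds P wstar γ σsq where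
  second := h.second
  fourth := h.fourth
  noise := by
    refine h.noise_exists.norm.congr (Filter.Eventually.of_forall fun z => ?_)
    simp only [norm_smul, norm_outer, Real.norm_of_nonneg (sq_nonneg (z.2 - inner ℝ wstar z.1))]
  fourth_le u := by
    have h1 := h.fourth_le _ (ContinuousLinearMap.isPositive_one (𝕜 := ℝ) (E := E))
    rw [ContinuousLinearMap.le_def] at h1
    have h2 := h1.inner_nonneg_right u
    rw [ContinuousLinearMap.one_def, ContinuousLinearMap.comp_id, sub_apply,
      inner_sub_right, fourthMoment_id h.fourth, smul_apply,
      inner_smul_right] at h2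
    have ht := Regular.trace_pos hα hγ hγle
    have h3 : α * trace b (secondMoment P) ≤ γ⁻¹ := by
      rw [one_div] at hγle
      exact le_inv_of_le_inv₀ hγ hγle
    nlinarith [secondMoment_self_nonneg h.second u]
  noise_le u := by
    obtain ⟨S, hS, hSle⟩ := h.noise_le
    rw [← inner_noiseCov h.noise_exists]
    exact hS.inner_le hSle u
  noise_mean := integral_residual_eq_zero h.second h.response h.risk_le

end Moments

/-! ### Fubini for independent variables. -/

section Independence

variable {Ω G S : Type*} [MeasurableSpace Ω] [MeasurableSpace G] [MeasurableSpace S]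
  {μ : Measure Ω} [IsProbabilityMeasure μ] {P : Measure S} {U : Ω → G} {X : Ω → S}

lemma integrable_prod_of_indepFun (hU : Measurable U) (hX : Measurable X) (hP : μ.map X = P)
    (h : IndepFun U X μ) {f : G × S → ℝ} (hf : Measurable f)
    (hi : Integrable (fun ω => f (U ω, X ω)) μ) : Integrable f ((μ.map U).prod P) := by
  have hm := (indepFun_iff_map_prod_eq_prod_map_map hU.aemeasurable hX.aemeasurable).1 h
  rw [← hP, ← hm]
  exact (integrable_map_measure hf.aestronglyMeasurable
    (hU.prodMk hX).aemeasurable).2 hi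

lemma integral_eq_integral_prod_of_indepFun (hU : Measurable U) (hX : Measurable X)
    (hP : μ.map X = P) (h : IndepFun U X μ) {f : G × S → ℝ} (hf : Measurable f) :
    ∫ ω, f (U ω, X ω) ∂μ = ∫ p, f p ∂((μ.map U).prod P) := by
  have hm := (indepFun_iff_map_prod_eq_prod_map_map hU.aemeasurable hX.aemeasurable).1 h
  rw [← hP, ← hm, integral_map (hU.prodMk hX).aemeasurable hf.aestronglyMeasurable]

/-- Integrate out the second of two independent variables first. -/
lemma integral_of_indepFun_left (hU : Measurable U) (hX : Measurable X) (hP : μ.map X = P)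
    (h : IndepFun U X μ) {f : G × S → ℝ} (hf : Measurable f)
    (hi : Integrable (fun ω => f (U ω, X ω)) μ) :
    Integrable (fun ω => ∫ z, f (U ω, z) ∂P) μ ∧
      ∫ ω, f (U ω, X ω) ∂μ = ∫ ω, ∫ z, f (U ω, z) ∂P ∂μ := by
  have : IsProbabilityMeasure P := hP ▸ Measure.isProbabilityMeasure_map hX.aemeasurable
  have := Measure.isProbabilityMeasure_map (μ := μ) hU.aemeasurable
  have h1 := integrable_prod_of_indepFun hU hX hP h hf hi
  refine ⟨h1.integral_prod_left.comp_measurable hU, ?_⟩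
  rw [integral_eq_integral_prod_of_indepFun hU hX hP h hf, integral_prod _ h1, integral_map
    hU.aemeasurable h1.integral_prod_left.aestronglyMeasurable]

/-- Integrate out the first of two independent variables first. -/
lemma integral_of_indepFun_right (hU : Measurable U) (hX : Measurable X) (hP : μ.map X = P)
    (h : IndepFun U X μ) {f : G × S → ℝ} (hf : Measurable f)
    (hi : Integrable (fun ω => f (U ω, X ω)) μ) :
    Integrable (fun z => ∫ ω, f (U ω, z) ∂μ) P ∧
      ∫ ω, f (U ω, X ω) ∂μ = ∫ z, ∫ ω, f (U ω, z) ∂μ ∂P := by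
  have : IsProbabilityMeasure P := hP ▸ Measure.isProbabilityMeasure_map hX.aemeasurable
  have := Measure.isProbabilityMeasure_map (μ := μ) hU.aemeasurable
  have h1 := integrable_prod_of_indepFun hU hX hP h hf hi
  have h2 : ∀ z, ∫ ω, f (U ω, z) ∂μ = ∫ v, f (v, z) ∂(μ.map U) := fun z => by
    have hz : Measurable fun v => f (v, z) := hf.comp (measurable_id.prodMk measurable_const)
    rw [integral_map hU.aemeasurable hz.aestronglyMeasurable]
  simp only [h2]
  refine ⟨h1.integral_prod_right, ?_⟩
  rw [integral_eq_integral_prod_of_indepFun hU hX hP h hf, integral_prod_symm _ h1]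

end Independence

/-! ### One step of the recursion. -/

section Step

variable {E : Type*} [NormedAddCommGroup E] [InnerProductSpace ℝ E]

/-- The operator `I - γ x xᵀ`. -/
def shrink (γ : ℝ) (x v : E) : E := v - (γ * inner ℝ v x) • x

lemma inner_shrink_left (γ : ℝ) (x v u : E) :
    inner ℝ (shrink γ x v) u = inner ℝ v u - γ * (inner ℝ v x * inner ℝ x u) := by
  rw [shrink, inner_sub_left, inner_smul_left, RCLike.conj_to_real]
  ring

/-- Self-adjointness moves the random operator onto the test vector, so that for a frozen sample
only directional moments of the iterate are needed. -/
lemma inner_shrink_comm (γ : ℝ) (x v u : E) :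
    inner ℝ (shrink γ x v) u = inner ℝ v (shrink γ x u) := by
  rw [← real_inner_comm v, inner_shrink_left, inner_shrink_left, real_inner_comm u v,
    real_inner_comm x u, real_inner_comm x v]
  ring

lemma norm_shrink_sq (γ : ℝ) (x v : E) :
    ‖shrink γ x v‖ ^ 2 =
      ‖v‖ ^ 2 - 2 * γ * inner ℝ x v ^ 2 + γ ^ 2 * (‖x‖ ^ 2 * inner ℝ x v ^ 2) := by
  rw [shrink, norm_sub_sq_real, norm_smul, inner_smul_right, mul_pow, Real.norm_eq_abs, sq_abs,
    real_inner_comm v x]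
  ring

variable [CompleteSpace E] [SecondCountableTopology E] [MeasurableSpace E] [BorelSpace E]
  {P : Measure (E × ℝ)} {wstar : E} {γ σsq : ℝ}

lemma MomentBounds.integrable_norm_shrink_sq [IsProbabilityMeasure P]
    (hB : MomentBounds P wstar γ σsq) (u : E) :
    Integrable (fun z : E × ℝ => ‖shrink γ z.1 u‖ ^ 2) P := by
  simp only [norm_shrink_sq]
  exact ((integrable_const _).sub ((integrable_inner_sq hB.second u).const_mul (2 * γ))).add
    ((integrable_fourth_inner hB.fourth u).const_mul (γ ^ 2))

/-- On average `I - γ x xᵀ` decreases squared norms. -/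
lemma MomentBounds.integral_norm_shrink_sq_le [IsProbabilityMeasure P]
    (hB : MomentBounds P wstar γ σsq) (hγ : 0 < γ) (u : E) :
    ∫ z, ‖shrink γ z.1 u‖ ^ 2 ∂P ≤ ‖u‖ ^ 2 - γ * inner ℝ u (secondMoment P u) := by
  have h1 : Integrable (fun z : E × ℝ => ‖u‖ ^ 2 - 2 * γ * inner ℝ z.1 u ^ 2) P :=
    (integrable_const _).sub ((integrable_inner_sq hB.second u).const_mul (2 * γ))
  simp only [norm_shrink_sq]
  rw [integral_add h1 ((integrable_fourth_inner hB.fourth u).const_mul (γ ^ 2)),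
    integral_sub (integrable_const _) ((integrable_inner_sq hB.second u).const_mul (2 * γ)),
    integral_const_mul, integral_const_mul, ← secondMoment_self hB.second]
  -- The second-order term costs at most γ⟨u,Hu⟩, half of the first-order gain 2γ⟨u,Hu⟩.
  have h2 := mul_le_mul_of_nonneg_left (hB.fourth_le u) (sq_nonneg γ)
  rw [← mul_assoc (γ ^ 2) γ⁻¹, sq, mul_assoc γ γ γ⁻¹, mul_inv_cancel₀ hγ.ne', mul_one, ← sq] at h2
  simp only [integral_const, probReal_univ, one_smul]
  linarith

lemma MomentBounds.integrable_noise_inner_sq (hB : MomentBounds P wstar γ σsq) (u : E) :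
    Integrable (fun z : E × ℝ => ((z.2 - inner ℝ wstar z.1) * inner ℝ z.1 u) ^ 2) P := by
  refine (hB.noise.mul_const (‖u‖ ^ 2)).mono' (by fun_prop)
    (Filter.Eventually.of_forall fun z => ?_)
  rw [Real.norm_of_nonneg (by positivity), mul_pow, mul_assoc]
  gcongr
  rw [← mul_pow, ← sq_abs]
  gcongr
  exact abs_real_inner_le_norm _ _

lemma MomentBounds.integrable_noise_inner [IsProbabilityMeasure P]
    (hB : MomentBounds P wstar γ σsq) (u : E) :
    Integrable (fun z : E × ℝ => (z.2 - inner ℝ wstar z.1) * inner ℝ z.1 u) P :=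
  ((memLp_two_iff_integrable_sq (by fun_prop)).2 (hB.integrable_noise_inner_sq u)).integrable
    (by norm_num)

/-- One step of the stochastic recursion driven by the gradient noise at `wstar`. -/
def noiseStep (γ : ℝ) (wstar : E) (z : E × ℝ) (v : E) : E :=
  shrink γ z.1 v + (γ * (z.2 - inner ℝ wstar z.1)) • z.1

lemma inner_noiseStep (z : E × ℝ) (v u : E) :
    inner ℝ (noiseStep γ wstar z v) u =
      inner ℝ v (shrink γ z.1 u) + γ * ((z.2 - inner ℝ wstar z.1) * inner ℝ z.1 u) := by
  rw [noiseStep, inner_add_left, inner_shrink_comm, inner_smul_left, RCLike.conj_to_real]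
  ring

lemma inner_noiseStep' (z : E × ℝ) (v u : E) :
    inner ℝ (noiseStep γ wstar z v) u = (inner ℝ v u - γ * (inner ℝ z.1 v * inner ℝ z.1 u)) +
      γ * ((z.2 - inner ℝ wstar z.1) * inner ℝ z.1 u) := by
  rw [inner_noiseStep, ← inner_shrink_comm, inner_shrink_left, real_inner_comm v z.1]

lemma measurable_shrink :
    Measurable (fun p : E × (E × ℝ) => shrink γ p.2.1 p.1) := by
  unfold shrink
  fun_prop

lemma measurable_noiseStep :
    Measurable (fun p : E × (E × ℝ) => noiseStep γ wstar p.2 p.1) := by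
  unfold noiseStep
  exact measurable_shrink.add (by fun_prop)

variable {Ω : Type*} [MeasurableSpace Ω] {μ : Measure Ω} [IsProbabilityMeasure μ]
  {X : Ω → E × ℝ} {v : Ω → E}

/-- The subtracted term has squared norm at most γ²‖v‖²‖x‖⁴, which is integrable because
independence factors it. -/
lemma MomentBounds.memLp_shrink (hB : MomentBounds P wstar γ σsq) (hX : Measurable X)
    (hP : μ.map X = P) (hv : Measurable v) (hv2 : MemLp v 2 μ) (hind : IndepFun v X μ) :
    MemLp (fun ω => shrink γ (X ω).1 (v ω)) 2 μ := by
  have h4 : Integrable (fun ω => ‖(X ω).1‖ ^ 4) μ := by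
    rw [← hP] at hB
    exact hB.fourth.comp_measurable hX
  have hv' := (memLp_two_iff_integrable_sq_norm hv.aestronglyMeasurable).1 hv2
  have hprod : Integrable (fun ω => ‖v ω‖ ^ 2 * ‖(X ω).1‖ ^ 4) μ :=
    (hind.comp (φ := fun v => ‖v‖ ^ 2) (ψ := fun z : E × ℝ => ‖z.1‖ ^ 4) (by fun_prop)
      (by fun_prop)).integrable_mul hv' h4
  refine hv2.sub ((memLp_two_iff_integrable_sq_norm (by fun_prop)).2 ?_)
  refine (hprod.const_mul (γ ^ 2)).mono' (by fun_prop) (Filter.Eventually.of_forall fun ω => ?_)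
  rw [Real.norm_of_nonneg (by positivity), norm_smul, mul_pow, Real.norm_eq_abs, sq_abs, mul_pow,
    mul_assoc]
  refine mul_le_mul_of_nonneg_left ?_ (sq_nonneg γ)
  have : inner ℝ (v ω) (X ω).1 ^ 2 ≤ (‖v ω‖ * ‖(X ω).1‖) ^ 2 := by
    rw [← sq_abs]
    gcongr
    exact abs_real_inner_le_norm _ _
  calc _ ≤ (‖v ω‖ * ‖(X ω).1‖) ^ 2 * ‖(X ω).1‖ ^ 2 := by gcongr
    _ = _ := by ring

lemma MomentBounds.memLp_noiseStep (hB : MomentBounds P wstar γ σsq) (hX : Measurable X)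
    (hP : μ.map X = P) (hv : Measurable v) (hv2 : MemLp v 2 μ) (hind : IndepFun v X μ) :
    MemLp (fun ω => noiseStep γ wstar (X ω) (v ω)) 2 μ := by
  refine (hB.memLp_shrink hX hP hv hv2 hind).add
    ((memLp_two_iff_integrable_sq_norm (by fun_prop)).2 ?_)
  rw [← hP] at hB
  refine ((hB.noise.comp_measurable hX).const_mul (γ ^ 2)).congr
    (Filter.Eventually.of_forall fun ω => ?_)
  simp only [Function.comp, norm_smul, mul_pow, Real.norm_eq_abs, sq_abs]
  ring

lemma MomentBounds.integral_norm_shrink_sq_le_of_indepFun (hB : MomentBounds P wstar γ σsq)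
    (hγ : 0 < γ) (hX : Measurable X)
    (hP : μ.map X = P) (hv : Measurable v) (hv2 : MemLp v 2 μ) (hind : IndepFun v X μ) :
    ∫ ω, ‖shrink γ (X ω).1 (v ω)‖ ^ 2 ∂μ ≤
      ∫ ω, ‖v ω‖ ^ 2 ∂μ - γ * ∫ ω, inner ℝ (v ω) (secondMoment P (v ω)) ∂μ := by
  have : IsProbabilityMeasure P := hP ▸ Measure.isProbabilityMeasure_map hX.aemeasurable
  have hi := (hB.memLp_shrink hX hP hv hv2 hind).integrable_norm_pow two_ne_zero
  obtain ⟨h1, h2⟩ := integral_of_indepFun_left hv hX hP hind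
    (f := fun p => ‖shrink γ p.2.1 p.1‖ ^ 2) (measurable_shrink.norm.pow_const 2) hi
  have hq : Integrable (fun ω => inner ℝ (v ω) (secondMoment P (v ω))) μ := by
    refine ((hv2.integrable_norm_pow two_ne_zero).const_mul ‖secondMoment P‖).mono' (by fun_prop)
      (Filter.Eventually.of_forall fun ω => ?_)
    refine (norm_inner_le_norm _ _).trans ?_
    calc _ ≤ ‖v ω‖ * (‖secondMoment P‖ * ‖v ω‖) := by
          gcongr
          exact ContinuousLinearMap.le_opNorm _ _
      _ = _ := by ring
  have hn := hv2.integrable_norm_pow two_ne_zero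
  rw [h2, ← integral_const_mul, ← integral_sub hn (hq.const_mul γ)]
  exact integral_mono h1 (hn.sub (hq.const_mul γ)) fun ω =>
    hB.integral_norm_shrink_sq_le hγ (v ω)

/-- In expectation the recursion acts as `I - γ H`, against any past square integrable weight. -/
lemma MomentBounds.integral_mul_inner_noiseStep (hB : MomentBounds P wstar γ σsq)
    (hX : Measurable X) (hP : μ.map X = P) (hv : Measurable v) (hv2 : MemLp v 2 μ) {φ : Ω → ℝ}
    (hφ : Measurable φ) (hφ2 : MemLp φ 2 μ) (hind : IndepFun (fun ω => (φ ω, v ω)) X μ) (u : E) :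
    ∫ ω, φ ω * inner ℝ (noiseStep γ wstar (X ω) (v ω)) u ∂μ =
      ∫ ω, φ ω * inner ℝ (v ω) u ∂μ - γ * ∫ ω, φ ω * inner ℝ (v ω) (secondMoment P u) ∂μ := by
  have : IsProbabilityMeasure P := hP ▸ Measure.isProbabilityMeasure_map hX.aemeasurable
  have hind' : IndepFun v X μ := hind.comp (φ := Prod.snd) (ψ := id) measurable_snd measurable_id
  have hL := hB.memLp_noiseStep hX hP hv hv2 hind'
  have hm : Measurable (fun p : (ℝ × E) × (E × ℝ) =>
      p.1.1 * inner ℝ (noiseStep γ wstar p.2 p.1.2) u) :=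
    (measurable_fst.comp measurable_fst).mul ((measurable_noiseStep.comp
      (((measurable_snd.comp measurable_fst)).prodMk measurable_snd)).inner_const)
  obtain ⟨h1, h2⟩ := integral_of_indepFun_left (hφ.prodMk hv) hX hP hind hm
    (hφ2.integrable_mul (hL.inner_const u))
  have h3 : ∀ w : E, ∫ z, inner ℝ (noiseStep γ wstar z w) u ∂P =
      inner ℝ w u - γ * inner ℝ w (secondMoment P u) := fun w => by
    have ha := integrable_inner_mul_inner hB.second w u
    have hb : Integrable (fun z : E × ℝ => inner ℝ w u - γ * (inner ℝ z.1 w * inner ℝ z.1 u)) P :=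
      (integrable_const _).sub (ha.const_mul γ)
    simp only [inner_noiseStep']
    rw [integral_add hb ((hB.integrable_noise_inner u).const_mul γ),
      integral_sub (integrable_const _) (ha.const_mul γ), integral_const_mul, integral_const_mul,
      hB.noise_mean, ← secondMoment_apply hB.second]
    simp
  rw [h2]
  simp only [integral_const_mul, h3]
  rw [← integral_const_mul, ← integral_sub]
  · exact integral_congr_ae (Filter.Eventually.of_forall fun ω => by simp only; ring)
  · exact hφ2.integrable_mul (hv2.inner_const u)
  · exact (hφ2.integrable_mul (hv2.inner_const _)).const_mul γ

/-- The second moment of a centred iterate stays below `γ σ² I`. -/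
lemma MomentBounds.integral_inner_noiseStep_sq_le (hB : MomentBounds P wstar γ σsq)
    (hγ : 0 < γ) (hσ : 0 ≤ σsq)
    (hX : Measurable X) (hP : μ.map X = P) (hv : Measurable v) (hv2 : MemLp v 2 μ)
    (hind : IndepFun v X μ) (hmean : ∀ u, ∫ ω, inner ℝ (v ω) u ∂μ = 0)
    (hle : ∀ u, ∫ ω, inner ℝ (v ω) u ^ 2 ∂μ ≤ γ * σsq * ‖u‖ ^ 2) (u : E) :
    ∫ ω, inner ℝ (noiseStep γ wstar (X ω) (v ω)) u ^ 2 ∂μ ≤ γ * σsq * ‖u‖ ^ 2 := by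
  have : IsProbabilityMeasure P := hP ▸ Measure.isProbabilityMeasure_map hX.aemeasurable
  have hL := hB.memLp_noiseStep hX hP hv hv2 hind
  obtain ⟨h1, h2⟩ := integral_of_indepFun_right hv hX hP hind
    (f := fun p => inner ℝ (noiseStep γ wstar p.2 p.1) u ^ 2)
    (measurable_noiseStep.inner_const.pow_const 2) (hL.inner_const (𝕜 := ℝ) u).integrable_sq
  rw [h2]
  -- For a frozen sample the cross term vanishes because the iterate is centred, and `hle` applies
  -- in the direction `shrink γ z.1 u`.
  have h3 : ∀ z : E × ℝ, ∫ ω, inner ℝ (noiseStep γ wstar z (v ω)) u ^ 2 ∂μ ≤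
      γ * σsq * ‖shrink γ z.1 u‖ ^ 2 +
        γ ^ 2 * ((z.2 - inner ℝ wstar z.1) * inner ℝ z.1 u) ^ 2 := fun z => by
    set a := shrink γ z.1 u with ha
    set c := (z.2 - inner ℝ wstar z.1) * inner ℝ z.1 u with hc
    have hs := (hv2.inner_const (𝕜 := ℝ) a).integrable_sq
    have hl := (hv2.inner_const (𝕜 := ℝ) a).integrable (by norm_num)
    have he : ∀ ω, inner ℝ (noiseStep γ wstar z (v ω)) u ^ 2 =
        (inner ℝ (v ω) a ^ 2 + 2 * γ * c * inner ℝ (v ω) a) + γ ^ 2 * c ^ 2 := fun ω => by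
      rw [inner_noiseStep]
      ring
    have hs2 : Integrable (fun ω => inner ℝ (v ω) a ^ 2 + 2 * γ * c * inner ℝ (v ω) a) μ :=
      hs.add (hl.const_mul _)
    simp only [he]
    rw [integral_add hs2 (integrable_const _), integral_add hs (hl.const_mul _),
      integral_const_mul, hmean]
    simpa using hle a
  have hi1 := (hB.integrable_norm_shrink_sq u).const_mul (γ * σsq)
  have hi2 := (hB.integrable_noise_inner_sq u).const_mul (γ ^ 2)
  refine (integral_mono h1 (hi1.add hi2) h3).trans ?_
  rw [integral_add' hi1 hi2, integral_const_mul, integral_const_mul]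
  -- The contraction frees γσ² · γ⟨u,Hu⟩, exactly the most that the fresh noise can add.
  have h4 := mul_le_mul_of_nonneg_left (hB.integral_norm_shrink_sq_le hγ u)
    (mul_nonneg hγ.le hσ)
  have h5 := mul_le_mul_of_nonneg_left (hB.noise_le u) (sq_nonneg γ)
  nlinarith

/-- In an eigendirection the second moment grows at most linearly. -/
lemma MomentBounds.integral_inner_noiseStep_sq_le_add (hB : MomentBounds P wstar γ σsq)
    (hγ : 0 < γ) (hσ : 0 ≤ σsq)
    (hX : Measurable X) (hP : μ.map X = P) (hv : Measurable v) (hv2 : MemLp v 2 μ)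
    (hind : IndepFun v X μ) (hmean : ∀ u, ∫ ω, inner ℝ (v ω) u ∂μ = 0)
    (hle : ∀ u, ∫ ω, inner ℝ (v ω) u ^ 2 ∂μ ≤ γ * σsq * ‖u‖ ^ 2) {u : E} {l : ℝ} (hl : 0 ≤ l)
    (hu : secondMoment P u = l • u) (hu1 : ‖u‖ = 1) :
    ∫ ω, inner ℝ (noiseStep γ wstar (X ω) (v ω)) u ^ 2 ∂μ ≤
      ∫ ω, inner ℝ (v ω) u ^ 2 ∂μ + 2 * γ ^ 2 * σsq * l := by
  have : IsProbabilityMeasure P := hP ▸ Measure.isProbabilityMeasure_map hX.aemeasurable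
  have hq : inner ℝ u (secondMoment P u) = l := by
    rw [hu, inner_smul_right, real_inner_self_eq_norm_sq, hu1]
    ring
  have hL := (hB.memLp_noiseStep hX hP hv hv2 hind).inner_const (𝕜 := ℝ) u
  have hvu := hv2.inner_const (𝕜 := ℝ) u
  have hd : MemLp (fun ω => inner ℝ (noiseStep γ wstar (X ω) (v ω)) u - inner ℝ (v ω) u) 2 μ :=
    hL.sub hvu
  have hcross := hB.integral_mul_inner_noiseStep hX hP hv hv2 (hv.inner_const (c := u)) hvu
    (hind.comp (φ := fun v => (inner ℝ v u, v)) (ψ := id) (by fun_prop) measurable_id) u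
  rw [hu] at hcross
  simp only [inner_smul_right, mul_left_comm _ l, integral_const_mul] at hcross
  have hvv : 0 ≤ ∫ ω, inner ℝ (v ω) u * inner ℝ (v ω) u ∂μ :=
    integral_nonneg fun ω => mul_self_nonneg _
  obtain ⟨h1, h2⟩ := integral_of_indepFun_right hv hX hP hind
    (f := fun p => (inner ℝ (noiseStep γ wstar p.2 p.1) u - inner ℝ p.1 u) ^ 2)
    ((measurable_noiseStep.inner_const.sub measurable_fst.inner_const).pow_const 2)
    hd.integrable_sq
  -- The increment is γ⟨x,u⟩ times residual minus ⟨v,x⟩. Averaging over the centred `v` leaves two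
  -- terms; after averaging over the sample each is worth at most γ²σ²l, whence the factor 2.
  have h3 : ∀ z : E × ℝ, ∫ ω, (inner ℝ (noiseStep γ wstar z (v ω)) u - inner ℝ (v ω) u) ^ 2 ∂μ ≤
      γ ^ 2 * (γ * σsq) * (‖z.1‖ ^ 2 * inner ℝ z.1 u ^ 2) +
        γ ^ 2 * ((z.2 - inner ℝ wstar z.1) * inner ℝ z.1 u) ^ 2 := fun z => by
    have hs := (hv2.inner_const (𝕜 := ℝ) z.1).integrable_sq
    have hl := (hv2.inner_const (𝕜 := ℝ) z.1).integrable (by norm_num)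
    set e := z.2 - inner ℝ wstar z.1 with he
    have heq : ∀ ω, (inner ℝ (noiseStep γ wstar z (v ω)) u - inner ℝ (v ω) u) ^ 2 =
        γ ^ 2 * inner ℝ z.1 u ^ 2 *
          ((inner ℝ (v ω) z.1 ^ 2 + (-2 * e) * inner ℝ (v ω) z.1) + e ^ 2) := fun ω => by
      rw [inner_noiseStep', real_inner_comm (v ω) z.1]
      ring
    have hs2 : Integrable (fun ω => inner ℝ (v ω) z.1 ^ 2 + (-2 * e) * inner ℝ (v ω) z.1) μ :=
      hs.add (hl.const_mul _)
    simp only [heq]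
    rw [integral_const_mul, integral_add hs2 (integrable_const _), integral_add hs
      (hl.const_mul _), integral_const_mul, hmean]
    simp only [mul_zero, add_zero, integral_const, probReal_univ, one_smul]
    calc _ ≤ γ ^ 2 * inner ℝ z.1 u ^ 2 * (γ * σsq * ‖z.1‖ ^ 2 + e ^ 2) := by
          gcongr
          exact hle _
      _ = _ := by ring
  have hi1 := (integrable_fourth_inner hB.fourth u).const_mul (γ ^ 2 * (γ * σsq))
  have hi2 := (hB.integrable_noise_inner_sq u).const_mul (γ ^ 2)
  have h4 := integral_mono h1 (hi1.add hi2) h3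
  rw [integral_add' hi1 hi2, integral_const_mul, integral_const_mul, ← h2] at h4
  have h5 := mul_le_mul_of_nonneg_left (hB.fourth_le u)
    (by positivity : 0 ≤ γ ^ 2 * (γ * σsq))
  have h6 := mul_le_mul_of_nonneg_left (hB.noise_le u) (sq_nonneg γ)
  rw [hq] at h5 h6
  have h7 : γ ^ 2 * (γ * σsq) * (γ⁻¹ * l) = γ ^ 2 * (σsq * l) := by
    field_simp
  -- Writing L² = 2vL - v² + (L - v)² isolates the drift: E[vL] = (1 - γl)E[v²], so the first two
  -- terms contribute at most E[v²].
  have hexp : ∀ ω, inner ℝ (noiseStep γ wstar (X ω) (v ω)) u ^ 2 =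
      (2 * (inner ℝ (v ω) u * inner ℝ (noiseStep γ wstar (X ω) (v ω)) u)
        - inner ℝ (v ω) u ^ 2) +
      (inner ℝ (noiseStep γ wstar (X ω) (v ω)) u - inner ℝ (v ω) u) ^ 2 := fun ω => by ring
  have hc1 : Integrable (fun ω => inner ℝ (v ω) u *
      inner ℝ (noiseStep γ wstar (X ω) (v ω)) u) μ := hvu.integrable_mul hL
  have hc2 : Integrable (fun ω => 2 * (inner ℝ (v ω) u *
      inner ℝ (noiseStep γ wstar (X ω) (v ω)) u) - inner ℝ (v ω) u ^ 2) μ :=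
    (hc1.const_mul 2).sub hvu.integrable_sq
  simp only [hexp]
  rw [integral_add hc2 hd.integrable_sq, integral_sub (hc1.const_mul 2) hvu.integrable_sq,
    integral_const_mul, hcross]
  simp only [← sq] at hvv ⊢
  have h8 : 0 ≤ γ * (l * ∫ ω, inner ℝ (v ω) u ^ 2 ∂μ) := by positivity
  linarith

end Step

/-! ### Bias and noise iterates and their averages. -/

section Iterates

variable {E : Type*} [NormedAddCommGroup E] [InnerProductSpace ℝ E]

/-- The noiseless part of the SGD error, started at `β`. -/
def biasSeq (γ : ℝ) (β : E) (z : ℕ → E × ℝ) : ℕ → E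
  | 0 => β
  | t + 1 => shrink γ (z (t + 1)).1 (biasSeq γ β z t)

/-- The part of the SGD error caused by the gradient noise at `wstar`. -/
def noiseSeq (γ : ℝ) (wstar : E) (z : ℕ → E × ℝ) : ℕ → E
  | 0 => 0
  | t + 1 => noiseStep γ wstar (z (t + 1)) (noiseSeq γ wstar z t)

lemma sgd_eq_bias_add_noise (γ : ℝ) (w₀ wstar : E) (z : ℕ → E × ℝ) (t : ℕ) :
    sgd γ w₀ z t = wstar + biasSeq γ (w₀ - wstar) z t + noiseSeq γ wstar z t := by
  induction t with
  | zero => simp [sgd, biasSeq, noiseSeq]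
  | succ t ih =>
    rw [sgd, biasSeq, noiseSeq, noiseStep, shrink, shrink, ih]
    simp only [inner_add_left]
    module

/-- Average of the first `N` terms. -/
def avg (N : ℕ) (f : ℕ → E) : E := (N : ℝ)⁻¹ • ∑ t ∈ Finset.range N, f t

lemma sgdAvg_sub (γ : ℝ) (w₀ wstar : E) (z : ℕ → E × ℝ) {N : ℕ} (hN : N ≠ 0) :
    sgdAvg γ w₀ z N - wstar =
      avg N (biasSeq γ (w₀ - wstar) z) + avg N (noiseSeq γ wstar z) := by
  have hN' : (N : ℝ) ≠ 0 := Nat.cast_ne_zero.2 hN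
  rw [sgdAvg, avg, avg]
  simp only [sgd_eq_bias_add_noise γ w₀ wstar, Finset.sum_add_distrib, Finset.sum_const,
    Finset.card_range, ← Nat.cast_smul_eq_nsmul ℝ, smul_add, smul_smul, inv_mul_cancel₀ hN',
    one_smul]
  abel

variable [CompleteSpace E] [SecondCountableTopology E] [MeasurableSpace E] [BorelSpace E]

lemma measurable_biasSeq {Ω : Type*} {m : ℕ → MeasurableSpace Ω} (hm : Monotone m) (γ : ℝ) (β : E)
    {Z : ℕ → Ω → E × ℝ} (hZ : ∀ t, Measurable[m t] (Z t)) (t : ℕ) :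
    Measurable[m t] (fun ω => biasSeq γ β (fun t => Z t ω) t) := by
  induction t with
  | zero => exact measurable_const
  | succ t ih =>
    exact measurable_shrink.comp ((ih.mono (hm t.le_succ) le_rfl).prodMk (hZ (t + 1)))

lemma measurable_noiseSeq {Ω : Type*} {m : ℕ → MeasurableSpace Ω} (hm : Monotone m) (γ : ℝ)
    (wstar : E) {Z : ℕ → Ω → E × ℝ} (hZ : ∀ t, Measurable[m t] (Z t)) (t : ℕ) :
    Measurable[m t] (fun ω => noiseSeq γ wstar (fun t => Z t ω) t) := by
  induction t with
  | zero => exact measurable_const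
  | succ t ih =>
    exact measurable_noiseStep.comp ((ih.mono (hm t.le_succ) le_rfl).prodMk (hZ (t + 1)))

variable {P : Measure (E × ℝ)} {wstar : E} {γ σsq : ℝ}
  {Ω : Type*} [mΩ : MeasurableSpace Ω] {μ : Measure Ω} [IsProbabilityMeasure μ]
  {Z : ℕ → Ω → E × ℝ}

/-- The `σ`-algebras generated by the samples seen so far. -/
def past (hZ : ∀ t, Measurable (Z t)) : Filtration ℕ mΩ :=
  Filtration.natural Z fun t => (hZ t).stronglyMeasurable

lemma measurable_past (hZ : ∀ t, Measurable (Z t)) (t : ℕ) : Measurable[past hZ t] (Z t) :=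
  (Filtration.stronglyAdapted_natural (fun t => (hZ t).stronglyMeasurable) t).measurable

/-- The iterate at time t depends only on samples up to t; this is what lets every one-step estimate
be applied with the fresh sample `Z (t + 1)`. -/
lemma indepFun_of_past (hZ : ∀ t, Measurable (Z t)) (hind : iIndepFun Z μ) {t : ℕ} {G : Type*}
    [MeasurableSpace G] {U : Ω → G} (hU : Measurable[past hZ t] U) :
    IndepFun U (Z (t + 1)) μ := by
  rw [IndepFun_iff_Indep]
  exact (indep_of_indep_of_le_right (hind.indep_comap_natural_of_lt
    (fun t => (hZ t).stronglyMeasurable) t.lt_succ_self) hU.comap_le).symm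

lemma measurable_past_biasSeq (hZ : ∀ t, Measurable (Z t)) (γ : ℝ) (β : E) (t : ℕ) :
    Measurable[past hZ t] (fun ω => biasSeq γ β (fun t => Z t ω) t) :=
  measurable_biasSeq (fun _ _ h => (past hZ).mono h) γ β (measurable_past hZ) t

lemma measurable_past_noiseSeq (hZ : ∀ t, Measurable (Z t)) (γ : ℝ) (wstar : E) (t : ℕ) :
    Measurable[past hZ t] (fun ω => noiseSeq γ wstar (fun t => Z t ω) t) :=
  measurable_noiseSeq (fun _ _ h => (past hZ).mono h) γ wstar (measurable_past hZ) t

lemma MomentBounds.memLp_biasSeq (hB : MomentBounds P wstar γ σsq) (hZ : ∀ t, Measurable (Z t))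
    (hP : ∀ t, μ.map (Z t) = P) (hind : iIndepFun Z μ) (β : E) (t : ℕ) :
    MemLp (fun ω => biasSeq γ β (fun t => Z t ω) t) 2 μ := by
  induction t with
  | zero => exact memLp_const β
  | succ t ih =>
    have hm := measurable_past_biasSeq hZ γ β t
    exact hB.memLp_shrink (hZ _) (hP _) (hm.mono ((past hZ).le t) le_rfl) ih
      (indepFun_of_past hZ hind hm)

lemma MomentBounds.memLp_noiseSeq (hB : MomentBounds P wstar γ σsq) (hZ : ∀ t, Measurable (Z t))
    (hP : ∀ t, μ.map (Z t) = P) (hind : iIndepFun Z μ) (t : ℕ) :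
    MemLp (fun ω => noiseSeq γ wstar (fun t => Z t ω) t) 2 μ := by
  induction t with
  | zero => exact memLp_const 0
  | succ t ih =>
    have hm := measurable_past_noiseSeq hZ γ wstar t
    exact hB.memLp_noiseStep (hZ _) (hP _) (hm.mono ((past hZ).le t) le_rfl) ih
      (indepFun_of_past hZ hind hm)

lemma integrable_quadratic {v : Ω → E} (hv : MemLp v 2 μ) (T : E →L[ℝ] E) :
    Integrable (fun ω => inner ℝ (v ω) (T (v ω))) μ := by
  have hm : AEStronglyMeasurable (fun ω => inner ℝ (v ω) (T (v ω))) μ :=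
    hv.1.inner (T.continuous.comp_aestronglyMeasurable hv.1)
  refine ((hv.integrable_norm_pow two_ne_zero).const_mul ‖T‖).mono' hm
    (Filter.Eventually.of_forall fun ω => ?_)
  refine (norm_inner_le_norm _ _).trans ?_
  calc _ ≤ ‖v ω‖ * (‖T‖ * ‖v ω‖) := by
        gcongr
        exact ContinuousLinearMap.le_opNorm _ _
    _ = _ := by ring

/-- The total weighted energy of the bias is controlled by its initial value. -/
lemma MomentBounds.sum_integral_biasSeq_le (hB : MomentBounds P wstar γ σsq) (hγ : 0 < γ)
    (hZ : ∀ t, Measurable (Z t)) (hP : ∀ t, μ.map (Z t) = P) (hind : iIndepFun Z μ) (β : E)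
    (N : ℕ) :
    γ * ∑ t ∈ Finset.range N, ∫ ω, inner ℝ (biasSeq γ β (fun t => Z t ω) t)
      (secondMoment P (biasSeq γ β (fun t => Z t ω) t)) ∂μ +
        ∫ ω, ‖biasSeq γ β (fun t => Z t ω) N‖ ^ 2 ∂μ ≤ ‖β‖ ^ 2 := by
  induction N with
  | zero => simp [biasSeq]
  | succ t ih =>
    have hm := measurable_past_biasSeq hZ γ β t
    have h := hB.integral_norm_shrink_sq_le_of_indepFun hγ (hZ _) (hP _)
      (hm.mono ((past hZ).le t) le_rfl) (hB.memLp_biasSeq hZ hP hind β t)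
      (indepFun_of_past hZ hind hm)
    rw [Finset.sum_range_succ]
    simp only [biasSeq] at h ⊢
    linarith

/-- Convexity of the quadratic form: Cauchy–Schwarz for ⟨x, ·⟩ at each sample, then integration over
the sample. -/
lemma quadratic_avg_le (hx : Integrable (fun z : E × ℝ => ‖z.1‖ ^ 2) P) {N : ℕ} (hN : N ≠ 0)
    (f : ℕ → E) :
    inner ℝ (avg N f) (secondMoment P (avg N f)) ≤
      (N : ℝ)⁻¹ * ∑ t ∈ Finset.range N, inner ℝ (f t) (secondMoment P (f t)) := by
  have hN' : (0 : ℝ) < N := by positivity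
  simp only [secondMoment_self hx]
  rw [← integral_finsetSum _ fun t _ => integrable_inner_sq hx _, ← integral_const_mul]
  refine integral_mono (integrable_inner_sq hx _)
    ((integrable_finsetSum _ fun t _ => integrable_inner_sq hx _).const_mul _) fun z => ?_
  simp only [avg, inner_smul_right, inner_sum]
  have h := sq_sum_le_card_mul_sum_sq (s := Finset.range N) (f := fun t => inner ℝ z.1 (f t))
  rw [Finset.card_range] at h
  rw [mul_pow, inv_pow, ← div_eq_inv_mul, ← div_eq_inv_mul, div_le_div_iff₀ (by positivity) hN']
  nlinarith

lemma memLp_avg {f : ℕ → Ω → E} (hf : ∀ t, MemLp (f t) 2 μ) (N : ℕ) :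
    MemLp (fun ω => avg N fun t => f t ω) 2 μ :=
  (memLp_finsetSum _ fun t _ => hf t).const_smul (N : ℝ)⁻¹

lemma MomentBounds.integral_avg_biasSeq_le (hB : MomentBounds P wstar γ σsq) (hγ : 0 < γ)
    (hZ : ∀ t, Measurable (Z t)) (hP : ∀ t, μ.map (Z t) = P) (hind : iIndepFun Z μ) (β : E)
    {N : ℕ} (hN : N ≠ 0) :
    ∫ ω, inner ℝ (avg N (biasSeq γ β (fun t => Z t ω)))
      (secondMoment P (avg N (biasSeq γ β (fun t => Z t ω)))) ∂μ ≤ ‖β‖ ^ 2 / (γ * N) := by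
  have hN' : (0 : ℝ) < N := by positivity
  have hL := hB.memLp_biasSeq hZ hP hind β
  have hi := fun t => integrable_quadratic (hL t) (secondMoment P)
  have h1 := integral_mono (integrable_quadratic (memLp_avg hL N) (secondMoment P))
    ((integrable_finsetSum _ fun t _ => hi t).const_mul (N : ℝ)⁻¹)
    fun ω => quadratic_avg_le hB.second hN (biasSeq γ β (fun t => Z t ω))
  refine h1.trans ?_
  rw [integral_const_mul, integral_finsetSum _ fun t _ => hi t, le_div_iff₀ (by positivity)]
  have h2 := hB.sum_integral_biasSeq_le hγ hZ hP hind β N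
  have h3 : 0 ≤ ∫ ω, ‖biasSeq γ β (fun t => Z t ω) N‖ ^ 2 ∂μ :=
    integral_nonneg fun ω => sq_nonneg _
  calc _ = γ * ∑ t ∈ Finset.range N, (∫ ω, inner ℝ (biasSeq γ β (fun t => Z t ω) t)
        (secondMoment P (biasSeq γ β (fun t => Z t ω) t)) ∂μ) := by
        field_simp
    _ ≤ _ := by linarith

lemma MomentBounds.integral_inner_noiseSeq (hB : MomentBounds P wstar γ σsq)
    (hZ : ∀ t, Measurable (Z t)) (hP : ∀ t, μ.map (Z t) = P) (hind : iIndepFun Z μ) (t : ℕ)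
    (u : E) : ∫ ω, inner ℝ (noiseSeq γ wstar (fun t => Z t ω) t) u ∂μ = 0 := by
  induction t generalizing u with
  | zero => simp [noiseSeq]
  | succ t ih =>
    have hm := measurable_past_noiseSeq hZ γ wstar t
    have h := hB.integral_mul_inner_noiseStep (hZ (t + 1)) (hP _)
      (hm.mono ((past hZ).le t) le_rfl) (hB.memLp_noiseSeq hZ hP hind t) (φ := fun _ => 1)
      measurable_const (memLp_const 1) (indepFun_of_past hZ hind (measurable_const.prodMk hm)) u
    simp only [one_mul, ih, mul_zero, sub_zero] at h
    exact h

lemma MomentBounds.integral_inner_noiseSeq_sq_le (hB : MomentBounds P wstar γ σsq) (hγ : 0 < γ)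
    (hσ : 0 ≤ σsq) (hZ : ∀ t, Measurable (Z t)) (hP : ∀ t, μ.map (Z t) = P)
    (hind : iIndepFun Z μ) (t : ℕ) (u : E) :
    ∫ ω, inner ℝ (noiseSeq γ wstar (fun t => Z t ω) t) u ^ 2 ∂μ ≤ γ * σsq * ‖u‖ ^ 2 := by
  induction t generalizing u with
  | zero =>
    simp only [noiseSeq, inner_zero_left, ne_eq, OfNat.ofNat_ne_zero, not_false_eq_true, zero_pow,
      integral_zero]
    positivity
  | succ t ih =>
    have hm := measurable_past_noiseSeq hZ γ wstar t
    exact hB.integral_inner_noiseStep_sq_le hγ hσ (hZ _) (hP _)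
      (hm.mono ((past hZ).le t) le_rfl) (hB.memLp_noiseSeq hZ hP hind t)
      (indepFun_of_past hZ hind hm) (hB.integral_inner_noiseSeq hZ hP hind t) ih u

lemma MomentBounds.integral_inner_noiseSeq_sq_le_linear (hB : MomentBounds P wstar γ σsq)
    (hγ : 0 < γ) (hσ : 0 ≤ σsq) (hZ : ∀ t, Measurable (Z t)) (hP : ∀ t, μ.map (Z t) = P)
    (hind : iIndepFun Z μ) {u : E} {l : ℝ} (hl : 0 ≤ l)
    (hu : secondMoment P u = l • u) (hu1 : ‖u‖ = 1) (t : ℕ) :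
    ∫ ω, inner ℝ (noiseSeq γ wstar (fun t => Z t ω) t) u ^ 2 ∂μ ≤ t * (2 * γ ^ 2 * σsq * l) := by
  induction t with
  | zero => simp [noiseSeq]
  | succ t ih =>
    have hm := measurable_past_noiseSeq hZ γ wstar t
    have h := hB.integral_inner_noiseStep_sq_le_add hγ hσ (hZ (t + 1)) (hP _)
      (hm.mono ((past hZ).le t) le_rfl) (hB.memLp_noiseSeq hZ hP hind t)
      (indepFun_of_past hZ hind hm) (hB.integral_inner_noiseSeq hZ hP hind t)
      (hB.integral_inner_noiseSeq_sq_le hγ hσ hZ hP hind t) hl hu hu1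
    simp only [noiseSeq]
    push_cast
    linarith

/-- Given the past, one step multiplies the conditional mean along an eigenvector by 1 - γl; iterate
over the lag. -/
lemma MomentBounds.integral_inner_noiseSeq_mul (hB : MomentBounds P wstar γ σsq)
    (hZ : ∀ t, Measurable (Z t)) (hP : ∀ t, μ.map (Z t) = P)
    (hind : iIndepFun Z μ) {u : E} {l : ℝ} (hu : secondMoment P u = l • u) (s k : ℕ) :
    ∫ ω, inner ℝ (noiseSeq γ wstar (fun t => Z t ω) s) u *
      inner ℝ (noiseSeq γ wstar (fun t => Z t ω) (s + k)) u ∂μ =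
      (1 - γ * l) ^ k * ∫ ω, inner ℝ (noiseSeq γ wstar (fun t => Z t ω) s) u ^ 2 ∂μ := by
  induction k with
  | zero => simp [sq]
  | succ k ih =>
    have hs := ((measurable_past_noiseSeq hZ γ wstar s).mono
      ((past hZ).mono (Nat.le_add_right s k)) le_rfl).inner_const (𝕜 := ℝ) (c := u)
    have hm := measurable_past_noiseSeq hZ γ wstar (s + k)
    have h := hB.integral_mul_inner_noiseStep (hZ (s + k + 1)) (hP _)
      (hm.mono ((past hZ).le _) le_rfl) (hB.memLp_noiseSeq hZ hP hind _)
      (hs.mono ((past hZ).le _) le_rfl) ((hB.memLp_noiseSeq hZ hP hind s).inner_const u)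
      (indepFun_of_past hZ hind (hs.prodMk hm)) u
    rw [hu] at h
    simp only [inner_smul_right, mul_left_comm _ l, integral_const_mul, ih] at h
    exact Eq.trans h (by ring)

/-- Expanding the square one term at a time, each new term adds its variance and twice its
correlations with the earlier ones: at most 2c times a geometric sum. -/
lemma MomentBounds.integral_sum_noiseSeq_sq_le (hB : MomentBounds P wstar γ σsq)
    (hZ : ∀ t, Measurable (Z t)) (hP : ∀ t, μ.map (Z t) = P)
    (hind : iIndepFun Z μ) {u : E} {l : ℝ} (hu : secondMoment P u = l • u) (hl : γ * l ≤ 1)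
    {N : ℕ} {c G : ℝ} (hc0 : 0 ≤ c)
    (hc : ∀ t < N, ∫ ω, inner ℝ (noiseSeq γ wstar (fun t => Z t ω) t) u ^ 2 ∂μ ≤ c)
    (hG : ∀ m ≤ N, ∑ k ∈ Finset.range m, (1 - γ * l) ^ k ≤ G) :
    ∫ ω, (∑ t ∈ Finset.range N, inner ℝ (noiseSeq γ wstar (fun t => Z t ω) t) u) ^ 2 ∂μ ≤
      N * (2 * c * G) := by
  have hL := fun t => (hB.memLp_noiseSeq hZ hP hind t).inner_const (𝕜 := ℝ) u
  set a : ℕ → Ω → ℝ := fun t ω => inner ℝ (noiseSeq γ wstar (fun t => Z t ω) t) u with ha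
  suffices H : ∀ M ≤ N, ∫ ω, (∑ t ∈ Finset.range M, a t ω) ^ 2 ∂μ ≤ M * (2 * c * G) from
    H N le_rfl
  intro M hM
  induction M with
  | zero => simp
  | succ M ih =>
    have hS : MemLp (fun ω => ∑ t ∈ Finset.range M, a t ω) 2 μ :=
      memLp_finsetSum _ fun t _ => hL t
    have hcross : ∫ ω, (∑ t ∈ Finset.range M, a t ω) * a M ω ∂μ =
        ∑ s ∈ Finset.range M, (1 - γ * l) ^ (M - s) * ∫ ω, a s ω ^ 2 ∂μ := by
      simp only [Finset.sum_mul]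
      have hi : ∀ t, Integrable (fun ω => a t ω * a M ω) μ := fun t => (hL t).integrable_mul (hL M)
      rw [integral_finsetSum _ fun t _ => hi t]
      refine Finset.sum_congr rfl fun s hs => ?_
      have h := hB.integral_inner_noiseSeq_mul hZ hP hind hu s (M - s)
      rwa [Nat.add_sub_cancel' (Finset.mem_range.1 hs).le] at h
    have hexp : ∀ ω, (∑ t ∈ Finset.range (M + 1), a t ω) ^ 2 =
        ((∑ t ∈ Finset.range M, a t ω) ^ 2 + 2 * ((∑ t ∈ Finset.range M, a t ω) * a M ω)) +
          a M ω ^ 2 := fun ω => by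
      rw [Finset.sum_range_succ]
      ring
    have hi : Integrable (fun ω => (∑ t ∈ Finset.range M, a t ω) * a M ω) μ :=
      hS.integrable_mul (hL M)
    have hi2 : Integrable (fun ω => (∑ t ∈ Finset.range M, a t ω) ^ 2 +
      2 * ((∑ t ∈ Finset.range M, a t ω) * a M ω)) μ := hS.integrable_sq.add (hi.const_mul 2)
    simp only [hexp]
    rw [integral_add hi2 (hL M).integrable_sq, integral_add hS.integrable_sq (hi.const_mul 2),
      integral_const_mul, hcross]
    have h1 : ∑ s ∈ Finset.range M, (1 - γ * l) ^ (M - s) * ∫ ω, a s ω ^ 2 ∂μ ≤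
        (∑ s ∈ Finset.range M, (1 - γ * l) ^ (M - s)) * c := by
      rw [Finset.sum_mul]
      refine Finset.sum_le_sum fun s hs => ?_
      exact mul_le_mul_of_nonneg_left (hc s (by have := Finset.mem_range.1 hs; omega))
        (pow_nonneg (by linarith) _)
    -- After reflection the geometric sum of length `M + 1` consists of lags M, …, 1 and lag 0; the
    -- latter is the summand 1 and pays for the variance of the new term.
    have h2 : ∑ s ∈ Finset.range M, (1 - γ * l) ^ (M - s) + 1 ≤ G := by
      have h3 := hG (M + 1) hM
      rw [← Finset.sum_range_reflect, Finset.sum_range_succ] at h3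
      simpa using h3
    have h4 := hc M hM
    have h5 := ih (by omega)
    have h6 := mul_le_mul_of_nonneg_right h2 hc0
    push_cast
    linarith

lemma MomentBounds.integral_inner_avg_noiseSeq_sq_le (hB : MomentBounds P wstar γ σsq)
    (hγ : 0 < γ) (hσ : 0 ≤ σsq) (hZ : ∀ t, Measurable (Z t)) (hP : ∀ t, μ.map (Z t) = P)
    (hind : iIndepFun Z μ) {u : E} {l : ℝ} (hl0 : 0 ≤ l) (hl : γ * l ≤ 1)
    (hu : secondMoment P u = l • u) (hu1 : ‖u‖ = 1) {N : ℕ} (hN : N ≠ 0) :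
    l * ∫ ω, inner ℝ (avg N (noiseSeq γ wstar (fun t => Z t ω))) u ^ 2 ∂μ ≤
      4 * σsq / N * min 1 (N * γ * l) ^ 2 := by
  have hN' : (0 : ℝ) < N := by positivity
  have key : ∀ c G : ℝ, 0 ≤ c →
      (∀ t < N, ∫ ω, inner ℝ (noiseSeq γ wstar (fun t => Z t ω) t) u ^ 2 ∂μ ≤ c) →
      (∀ m ≤ N, ∑ k ∈ Finset.range m, (1 - γ * l) ^ k ≤ G) →
      l * ∫ ω, inner ℝ (avg N (noiseSeq γ wstar (fun t => Z t ω))) u ^ 2 ∂μ ≤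
        2 * c * (l * G) / N := fun c G hc0 hc hG => by
    have h := hB.integral_sum_noiseSeq_sq_le hZ hP hind hu hl hc0 hc hG
    have h2 : ∀ ω, inner ℝ (avg N (noiseSeq γ wstar (fun t => Z t ω))) u ^ 2 =
        ((N : ℝ)⁻¹) ^ 2 * (∑ t ∈ Finset.range N,
          inner ℝ (noiseSeq γ wstar (fun t => Z t ω) t) u) ^ 2 := fun ω => by
      rw [avg, real_inner_smul_left, sum_inner, mul_pow]
    simp only [h2, integral_const_mul]
    calc _ ≤ l * (((N : ℝ)⁻¹) ^ 2 * (N * (2 * c * G))) := by gcongr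
      _ = _ := by field_simp
  have hcrude := fun t => hB.integral_inner_noiseSeq_sq_le hγ hσ hZ hP hind t u
  have hlin := hB.integral_inner_noiseSeq_sq_le_linear hγ hσ hZ hP hind hl0 hu hu1
  have hγl : 0 ≤ γ * l := by positivity
  -- The time scale of the direction is 1/(γl). If it exceeds N, the variance is still growing
  -- linearly and all N lags count; otherwise the uniform variance bound and the full geometric
  -- series 1/(γl) are used.
  rcases le_total (N * γ * l) 1 with h | h
  · rw [min_eq_right h]
    refine (key (N * (2 * γ ^ 2 * σsq * l)) N (by positivity) (fun t ht => (hlin t).trans ?_)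
      fun m hm => ?_).trans_eq ?_
    · gcongr
    · calc _ ≤ ∑ k ∈ Finset.range m, (1 : ℝ) :=
            Finset.sum_le_sum fun k _ => pow_le_one₀ (by linarith) (by linarith)
        _ ≤ N := by simpa using hm
    · field_simp
      ring
  · rw [min_eq_left h]
    have hlpos : 0 < l := by
      rcases hl0.eq_or_lt with h0 | h0
      · rw [← h0, mul_zero] at h
        linarith
      · exact h0
    refine (key (γ * σsq) (γ * l)⁻¹ (by positivity) (fun t _ => by simpa [hu1] using hcrude t)
      fun m _ => ?_).trans ?_
    · have h1 := geom_sum_mul_neg (1 - γ * l) m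
      rw [sub_sub_cancel] at h1
      rw [← one_div, le_div_iff₀ (by positivity), h1]
      have := pow_nonneg (by linarith : 0 ≤ 1 - γ * l) m
      linarith
    · have : 2 * (γ * σsq) * (l * (γ * l)⁻¹) / N = 2 * σsq / N := by field_simp
      rw [this, one_pow, mul_one]
      gcongr
      norm_num

/-! ### Summation over eigendirections and the excess risk bound. -/

variable {ι : Type} [Countable ι] {b : HilbertBasis ι ℝ E} {lam : ι → ℝ}

lemma hasSum_quadratic (hx : Integrable (fun z : E × ℝ => ‖z.1‖ ^ 2) P)
    (hb : ∀ i, secondMoment P (b i) = lam i • b i) (w : E) :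
    HasSum (fun i => lam i * inner ℝ w (b i) ^ 2) (inner ℝ w (secondMoment P w)) := by
  refine (b.hasSum_inner_mul_inner w (secondMoment P w)).congr_fun fun i => ?_
  rw [← secondMoment_symm hx, hb, inner_smul_left, RCLike.conj_to_real, real_inner_comm w (b i)]
  ring

lemma eigenvalue_nonneg (hx : Integrable (fun z : E × ℝ => ‖z.1‖ ^ 2) P)
    (hb : ∀ i, secondMoment P (b i) = lam i • b i) (i : ι) : 0 ≤ lam i := by
  have h := secondMoment_self_nonneg hx (b i)
  rwa [hb, inner_smul_right, real_inner_self_eq_norm_sq, b.orthonormal.1 i, one_pow, mul_one] at h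

/-- The stepsize condition forces `γ λ ≤ 1`, as `λ² ≤ E[⟪x, u⟫⁴] ≤ E[‖x‖² ⟪x, u⟫²] ≤ λ / γ`. -/
lemma MomentBounds.mul_eigenvalue_le_one [IsProbabilityMeasure P]
    (hB : MomentBounds P wstar γ σsq) (hγ : 0 < γ)
    {u : E} {l : ℝ} (hu : secondMoment P u = l • u) (hu1 : ‖u‖ = 1) : γ * l ≤ 1 := by
  have hq : inner ℝ u (secondMoment P u) = l := by
    rw [hu, inner_smul_right, real_inner_self_eq_norm_sq, hu1]
    ring
  have hl0 : 0 ≤ l := hq ▸ secondMoment_self_nonneg hB.second u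
  have h1 := hB.fourth_le u
  -- The tangent line 2ly - l² ≤ y² at y = ⟨x,u⟩², which has mean l, plays the role of Jensen's
  -- inequality.
  have h2 : ∫ z, (2 * l * inner ℝ z.1 u ^ 2 - l ^ 2) ∂P ≤
      ∫ z, ‖z.1‖ ^ 2 * inner ℝ z.1 u ^ 2 ∂P := by
    refine integral_mono (((integrable_inner_sq hB.second u).const_mul _).sub
      (integrable_const _)) (integrable_fourth_inner hB.fourth u) fun z => ?_
    have h3 : inner ℝ z.1 u ^ 2 ≤ ‖z.1‖ ^ 2 := by
      rw [← sq_abs]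
      gcongr
      simpa [hu1] using abs_real_inner_le_norm z.1 u
    simp only
    nlinarith [sq_nonneg (inner ℝ z.1 u ^ 2 - l), sq_nonneg (inner ℝ z.1 u)]
  rw [integral_sub ((integrable_inner_sq hB.second u).const_mul _) (integrable_const _),
    integral_const_mul, ← secondMoment_self hB.second, hq] at h2
  rw [hq] at h1
  simp only [integral_const, probReal_univ, one_smul] at h2
  have h3 : l * l ≤ γ⁻¹ * l := by linarith
  rcases hl0.eq_or_lt with h0 | h0
  · rw [← h0]
    simp
  · have h4 := le_of_mul_le_mul_right h3 h0
    calc γ * l ≤ γ * γ⁻¹ := by gcongr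
      _ = 1 := mul_inv_cancel₀ hγ.ne'

lemma MomentBounds.integral_avg_noiseSeq_le (hB : MomentBounds P wstar γ σsq)
    (hγ : 0 < γ) (hσ : 0 ≤ σsq) (hZ : ∀ t, Measurable (Z t)) (hP : ∀ t, μ.map (Z t) = P)
    (hind : iIndepFun Z μ) (hb : ∀ i, secondMoment P (b i) = lam i • b i)
    {N : ℕ} (hN : N ≠ 0) {B : ℝ} (hBd : ∀ F : Finset ι, ∑ i ∈ F, min 1 (N * γ * lam i) ^ 2 ≤ B) :
    ∫ ω, inner ℝ (avg N (noiseSeq γ wstar (fun t => Z t ω)))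
      (secondMoment P (avg N (noiseSeq γ wstar (fun t => Z t ω)))) ∂μ ≤ 4 * σsq / N * B := by
  have : IsProbabilityMeasure P := hP 0 ▸ Measure.isProbabilityMeasure_map (hZ 0).aemeasurable
  have hl0 := eigenvalue_nonneg hB.second hb
  have hL := memLp_avg (hB.memLp_noiseSeq hZ hP hind) N
  set w : Ω → E := fun ω => avg N (noiseSeq γ wstar (fun t => Z t ω)) with hw
  have hi : ∀ i, Integrable (fun ω => lam i * inner ℝ (w ω) (b i) ^ 2) μ := fun i =>
    (hL.inner_const (𝕜 := ℝ) (b i)).integrable_sq.const_mul _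
  have hle : ∀ i, ∫ ω, lam i * inner ℝ (w ω) (b i) ^ 2 ∂μ ≤
      4 * σsq / N * min 1 (N * γ * lam i) ^ 2 := fun i => by
    rw [integral_const_mul]
    exact hB.integral_inner_avg_noiseSeq_sq_le hγ hσ hZ hP hind (hl0 i)
      (hB.mul_eigenvalue_le_one hγ (hb i) (b.orthonormal.1 i)) (hb i) (b.orthonormal.1 i) hN
  have hnn : ∀ i, 0 ≤ ∫ ω, lam i * inner ℝ (w ω) (b i) ^ 2 ∂μ := fun i =>
    integral_nonneg fun ω => mul_nonneg (hl0 i) (sq_nonneg _)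
  have hfin : ∀ F : Finset ι, ∑ i ∈ F, ∫ ω, lam i * inner ℝ (w ω) (b i) ^ 2 ∂μ ≤
      4 * σsq / N * B := fun F => by
    refine (Finset.sum_le_sum fun i _ => hle i).trans ?_
    rw [← Finset.mul_sum]
    exact mul_le_mul_of_nonneg_left (hBd F) (by positivity)
  -- All terms are nonnegative, so the uniform bound on finite partial sums already justifies
  -- exchanging sum and expectation.
  have hsum := hasSum_integral_of_summable_integral_norm hi (by
    refine (summable_of_sum_le hnn hfin).congr fun i => integral_congr_ae
      (Filter.Eventually.of_forall fun ω => ?_)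
    exact (Real.norm_of_nonneg (mul_nonneg (hl0 i) (sq_nonneg _))).symm)
  have heq : ∀ ω, ∑' i, lam i * inner ℝ (w ω) (b i) ^ 2 =
      inner ℝ (w ω) (secondMoment P (w ω)) := fun ω =>
    (hasSum_quadratic hB.second hb (w ω)).tsum_eq
  simp only [heq] at hsum
  rw [← hsum.tsum_eq]
  exact Real.tsum_le_of_sum_le hnn hfin

/-- Nonnegativity of the form at `u - w`. The factor 2 later cancels the ½ in the risk. -/
lemma quadratic_add_le (hx : Integrable (fun z : E × ℝ => ‖z.1‖ ^ 2) P) (u w : E) :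
    inner ℝ (u + w) (secondMoment P (u + w)) ≤
      2 * inner ℝ u (secondMoment P u) + 2 * inner ℝ w (secondMoment P w) := by
  have h := secondMoment_self_nonneg hx (u - w)
  simp only [map_sub, map_add, inner_sub_left, inner_sub_right, inner_add_left,
    inner_add_right] at h ⊢
  linarith

lemma memLp_congr_add {f g h : Ω → E} (hf : MemLp f 2 μ) (hg : MemLp g 2 μ)
    (hh : ∀ ω, h ω = f ω + g ω) : MemLp h 2 μ := by
  rw [funext hh]
  exact hf.add hg

/-- The excess risk bound for measurable samples. -/
theorem Regular.excessRisk_le_of_measurable {α ρ : ℝ} {w₀ : E}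
    (h : Regular b P wstar α σsq) (hB : MomentBounds P wstar γ σsq)
    (hγ : 0 < γ) (hσ : 0 ≤ σsq) (hρ : ‖w₀ - wstar‖ ≤ ρ)
    (hZ : ∀ t, Measurable (Z t)) (hP : ∀ t, μ.map (Z t) = P)
    (hind : iIndepFun Z μ) (hb : ∀ i, secondMoment P (b i) = lam i • b i)
    {N : ℕ} (hN : N ≠ 0) {B : ℝ} (hBd : ∀ F : Finset ι, ∑ i ∈ F, min 1 (N * γ * lam i) ^ 2 ≤ B) :
    Integrable (fun ω => risk P (sgdAvg γ w₀ (fun t => Z t ω) N)) μ ∧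
      ∫ ω, risk P (sgdAvg γ w₀ (fun t => Z t ω) N) ∂μ - risk P wstar ≤
        ρ ^ 2 / (γ * N) + 4 * σsq / N * B := by
  have : IsProbabilityMeasure P := hP 0 ▸ Measure.isProbabilityMeasure_map (hZ 0).aemeasurable
  have hLb := memLp_avg (hB.memLp_biasSeq hZ hP hind (w₀ - wstar)) N
  have hLn := memLp_avg (hB.memLp_noiseSeq hZ hP hind) N
  have hL := memLp_congr_add hLb hLn
    fun ω => sgdAvg_sub γ w₀ wstar (fun t => Z t ω) hN
  have hr : ∀ ω, risk P (sgdAvg γ w₀ (fun t => Z t ω) N) = risk P wstar + (1 / 2) *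
      inner ℝ (sgdAvg γ w₀ (fun t => Z t ω) N - wstar)
        (secondMoment P (sgdAvg γ w₀ (fun t => Z t ω) N - wstar)) := fun ω => by
    rw [← h.risk_sub]
    ring
  have hq := integrable_quadratic hL (secondMoment P)
  simp only [hr]
  refine ⟨(integrable_const _).add (hq.const_mul _), ?_⟩
  rw [integral_add (integrable_const _) (hq.const_mul _), integral_const_mul]
  simp only [integral_const, probReal_univ, one_smul, add_sub_cancel_left]
  have hqb := (integrable_quadratic hLb (secondMoment P)).const_mul 2
  have hqn := (integrable_quadratic hLn (secondMoment P)).const_mul 2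
  have h1 := integral_mono hq (hqb.add hqn) fun ω => by
    simp only [sgdAvg_sub γ w₀ wstar (fun t => Z t ω) hN]
    exact quadratic_add_le hB.second _ _
  rw [integral_add' hqb hqn, integral_const_mul, integral_const_mul] at h1
  have h2 := hB.integral_avg_biasSeq_le hγ hZ hP hind (w₀ - wstar) hN
  have h3 := hB.integral_avg_noiseSeq_le hγ hσ hZ hP hind hb hN hBd
  have h4 : ‖w₀ - wstar‖ ^ 2 / (γ * N) ≤ ρ ^ 2 / (γ * N) := by gcongr
  linarith

lemma measurable_sgd (γ : ℝ) (w₀ : E) (t : ℕ) :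
    Measurable (fun z : ℕ → E × ℝ => sgd γ w₀ z t) := by
  induction t with
  | zero => exact measurable_const
  | succ t ih =>
    simp only [sgd]
    fun_prop

lemma measurable_sgdAvg (γ : ℝ) (w₀ : E) (N : ℕ) :
    Measurable (fun z : ℕ → E × ℝ => sgdAvg γ w₀ z N) :=
  (Finset.measurable_sum _ fun t _ => measurable_sgd γ w₀ t).const_smul (N : ℝ)⁻¹

lemma Regular.measurable_risk {α : ℝ} [IsProbabilityMeasure P] (h : Regular b P wstar α σsq) :
    Measurable (risk P) := by
  have hr : risk P = fun w => risk P wstar +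
      (1 / 2) * inner ℝ (w - wstar) (secondMoment P (w - wstar)) :=
    funext fun w => by
      rw [← h.risk_sub]
      ring
  rw [hr]
  fun_prop

/-- Excess risk bound for constant stepsize SGD with averaging. -/
theorem Regular.excessRisk_le {α ρ : ℝ} {w₀ : E} [IsProbabilityMeasure P]
    (h : Regular b P wstar α σsq) (hB : MomentBounds P wstar γ σsq)
    (hγ : 0 < γ) (hσ : 0 ≤ σsq) (hρ : ‖w₀ - wstar‖ ≤ ρ)
    (hind : iIndepFun Z μ) (hP : ∀ t, HasLaw (Z t) P μ)
    (hb : ∀ i, secondMoment P (b i) = lam i • b i)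
    {N : ℕ} (hN : N ≠ 0) {B : ℝ} (hBd : ∀ F : Finset ι, ∑ i ∈ F, min 1 (N * γ * lam i) ^ 2 ≤ B) :
    Integrable (fun ω => risk P (sgdAvg γ w₀ (fun t => Z t ω) N)) μ ∧
      ∫ ω, risk P (sgdAvg γ w₀ (fun t => Z t ω) N) ∂μ - risk P wstar ≤
        ρ ^ 2 / (γ * N) + 4 * σsq / N * B := by
  -- `HasLaw` gives only a.e. measurable samples. The claim depends only on their joint law, the
  -- infinite product of `P`, so it is proved for the coordinate maps on the product space and
  -- transported back.
  have hae : AEMeasurable (fun ω t => Z t ω) μ :=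
    aemeasurable_pi_lambda _ fun t => (hP t).aemeasurable
  have hmap : μ.map (fun ω t => Z t ω) = Measure.infinitePi fun _ : ℕ => P := by
    rw [(iIndepFun_iff_map_fun_eq_infinitePi_map₀' fun t => (hP t).aemeasurable).1 hind]
    exact congrArg _ (funext fun t => (hP t).map_eq)
  have hm := (h.measurable_risk.comp (measurable_sgdAvg γ w₀ N)).aestronglyMeasurable
    (μ := μ.map fun ω t => Z t ω)
  have key := Regular.excessRisk_le_of_measurable (μ := Measure.infinitePi fun _ : ℕ => P)
    (Z := fun t z => z t) h hB hγ hσ hρ (fun t => measurable_pi_apply t)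
    (fun t => (measurePreserving_eval_infinitePi (fun _ : ℕ => P) t).map_eq)
    (iIndepFun_infinitePi (X := fun _ z => z) fun _ => measurable_id) hb hN hBd
  rw [← hmap] at key
  exact ⟨(integrable_map_measure hm hae).1 key.1, by
    have := integral_map hae hm
    simp only [Function.comp] at this
    rw [← this]
    exact key.2⟩

end Iterates

/-! ### Effective dimension of the four spectra. -/

section Spectra

/-- Reduces a rate ε to two estimates: `A` controls the effective dimension relative to Nε (noise),
and `A'` controls 1/N relative to ε (bias). -/
lemma excessRiskLE_of_sum_le {α γ σsq ρ : ℝ} (hα : 0 < α) (hγ : 0 < γ) {N : ℕ} (hN : N ≠ 0)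
    {D : ℕ∞} {lam : ℕ → ℝ} {A A' ε : ℝ}
    (hS : ∀ F : Finset ℕ, (∀ k ∈ F, 1 ≤ k ∧ (k : ℕ∞) ≤ D) →
      ∑ k ∈ F, min 1 (N * γ * lam k) ^ 2 ≤ N * (A * ε))
    (hε : (N : ℝ)⁻¹ ≤ A' * ε) :
    ExcessRiskLE.{u, v} α γ σsq ρ N D lam ((ρ ^ 2 / γ * A' + 4 * |σsq| * A) * ε) := by
  intro E _ _ _ _ _ _ P _ b wstar w₀ Ω _ μ _ Z h hb hγle hρ hind hP
  have hσ : 0 ≤ σsq := by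
    obtain ⟨S, -, hS⟩ := h.noise_le
    exact (norm_nonneg S).trans hS
  have hN' : (0 : ℝ) < N := by positivity
  obtain ⟨h1, h2⟩ := h.excessRisk_le (h.momentBounds hα hγ hγle) hγ hσ hρ hind hP hb hN
    (B := N * (A * ε)) fun F => by
      have := hS (F.map (Function.Embedding.subtype _)) fun k hk => by
        obtain ⟨i, -, rfl⟩ := Finset.mem_map.1 hk
        exact i.2
      simpa using this
  refine ⟨h1, h2.trans ?_⟩
  rw [abs_of_nonneg hσ]
  calc _ = ρ ^ 2 / γ * (N : ℝ)⁻¹ + 4 * σsq * (A * ε) := by field_simp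
    _ ≤ ρ ^ 2 / γ * (A' * ε) + 4 * σsq * (A * ε) := by gcongr
    _ = _ := by ring

lemma min_one_sq_le_one {x : ℝ} (hx : 0 ≤ x) : min 1 x ^ 2 ≤ 1 :=
  pow_le_one₀ (le_min zero_le_one hx) (min_le_left _ _)

lemma sum_filter_inv_sq_le (F : Finset ℕ) {K : ℕ} (hK : K ≠ 0) :
    ∑ k ∈ F with K < k, ((k : ℝ) ^ 2)⁻¹ ≤ (K : ℝ)⁻¹ := by
  set n := max K (F.sup id)
  have hsub : F.filter (K < ·) ⊆ Finset.Ioc K n := fun k hk => by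
    rw [Finset.mem_filter] at hk
    exact Finset.mem_Ioc.2 ⟨hk.2, (Finset.le_sup (f := id) hk.1).trans (le_max_right _ _)⟩
  have h1 := sum_Ioc_inv_sq_le_sub (α := ℝ) hK (le_max_left K (F.sup id))
  have h2 : (0 : ℝ) ≤ (n : ℝ)⁻¹ := by positivity
  refine (Finset.sum_le_sum_of_subset_of_nonneg hsub fun k _ _ => by positivity).trans ?_
  linarith

lemma sum_filter_le_card {F : Finset ℕ} {g : ℕ → ℝ} (hF : ∀ k ∈ F, 1 ≤ k)
    (hg : ∀ k ∈ F, 0 ≤ g k) (K : ℕ) : ∑ k ∈ F with k ≤ K, min 1 (g k) ^ 2 ≤ K := by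
  have hsub : F.filter (· ≤ K) ⊆ Finset.Icc 1 K := fun k hk => by
    rw [Finset.mem_filter] at hk
    exact Finset.mem_Icc.2 ⟨hF k hk.1, hk.2⟩
  have hcard := Finset.card_le_card hsub
  rw [Nat.card_Icc, Nat.add_sub_cancel] at hcard
  refine (Finset.sum_le_card_nsmul _ _ 1 fun k hk =>
    min_one_sq_le_one (hg k (Finset.mem_filter.1 hk).1)).trans ?_
  rw [nsmul_eq_mul, mul_one]
  exact_mod_cast hcard

lemma sum_min_one_sq_eq (F : Finset ℕ) (g : ℕ → ℝ) (K : ℕ) :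
    ∑ k ∈ F, min 1 (g k) ^ 2 = ∑ k ∈ F with k ≤ K, min 1 (g k) ^ 2 +
      ∑ k ∈ F with K < k, min 1 (g k) ^ 2 := by
  simp only [← not_le]
  exact (Finset.sum_filter_add_sum_filter_not F (· ≤ K) _).symm

/-- The first `K` indices cost at most 1 each; the tail is compared with ∑_{k>K} k⁻² ≤ 1/K. The
three decaying spectra all use this, differing only in `K` and `T`. -/
lemma sum_min_one_sq_le {F : Finset ℕ} {g : ℕ → ℝ} {K : ℕ} {T : ℝ} (hF : ∀ k ∈ F, 1 ≤ k)
    (hg : ∀ k ∈ F, 0 ≤ g k) (hK : K ≠ 0) (hT : 0 ≤ T)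
    (hgT : ∀ k, K < k → g k ^ 2 ≤ T * ((k : ℝ) ^ 2)⁻¹) :
    ∑ k ∈ F, min 1 (g k) ^ 2 ≤ K + T * (K : ℝ)⁻¹ := by
  rw [sum_min_one_sq_eq F g K]
  refine add_le_add (sum_filter_le_card hF hg K) ?_
  calc ∑ k ∈ F with K < k, min 1 (g k) ^ 2
      ≤ ∑ k ∈ F with K < k, T * ((k : ℝ) ^ 2)⁻¹ := by
        refine Finset.sum_le_sum fun k hk => ?_
        rw [Finset.mem_filter] at hk
        exact (pow_le_pow_left₀ (le_min zero_le_one (hg k hk.1)) (min_le_right _ _) 2).trans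
          (hgT k hk.2)
    _ ≤ _ := by
        rw [← Finset.mul_sum]
        exact mul_le_mul_of_nonneg_left (sum_filter_inv_sq_le F hK) hT

lemma sum_twoLevel_le {F : Finset ℕ} {s d : ℕ} {c T : ℝ} (hc : 0 ≤ c) (hT : 0 ≤ T)
    (hF : ∀ k ∈ F, 1 ≤ k ∧ k ≤ d)
    (h : s < d → ((d : ℝ) - s) * min 1 (c * (1 / ((d : ℝ) - s))) ^ 2 ≤ T) :
    ∑ k ∈ F, min 1 (c * twoLevel s d k) ^ 2 ≤ s + T := by
  rw [sum_min_one_sq_eq F _ s]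
  have hg : ∀ k ∈ F, 0 ≤ c * twoLevel s d k := fun k hk => by
    refine mul_nonneg hc ?_
    rw [twoLevel]
    split_ifs with hks
    · positivity
    · have : (s : ℝ) < d := by exact_mod_cast (not_le.1 hks).trans_le (hF k hk).2
      exact one_div_nonneg.2 (by linarith)
  refine add_le_add (sum_filter_le_card (fun k hk => (hF k hk).1) hg s) ?_
  have hsub : F.filter (s < ·) ⊆ Finset.Ioc s d := fun k hk => by
    rw [Finset.mem_filter] at hk
    exact Finset.mem_Ioc.2 ⟨hk.2, (hF k hk.1).2⟩
  have hcard := Finset.card_le_card hsub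
  rw [Nat.card_Ioc] at hcard
  rcases lt_or_ge s d with hsd | hsd
  · refine le_trans ?_ (h hsd)
    rw [Finset.sum_congr rfl fun k hk => by
      rw [twoLevel, if_neg (not_le.2 (Finset.mem_filter.1 hk).2)], Finset.sum_const, nsmul_eq_mul,
      ← Nat.cast_sub hsd.le]
    gcongr
  · rw [Nat.sub_eq_zero_of_le hsd, Nat.le_zero, Finset.card_eq_zero] at hcard
    rw [hcard, Finset.sum_empty]
    exact hT

lemma excessRiskLE_twoLevel {α γ σsq ρ r q : ℝ} (hα : 0 < α) (hγ : 0 < γ) (hr : 0 < r)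
    (hr1 : r ≤ 1) {N s d : ℕ} (hN : 2 ≤ N) (hs : |(s : ℝ) - (N : ℝ) ^ r| < 1)
    (hd : |(d : ℝ) - (N : ℝ) ^ q| < 1) :
    ExcessRiskLE.{u, v} α γ σsq ρ N d (twoLevel s d)
      ((ρ ^ 2 / γ * 1 + 4 * |σsq| * (2 + 8 * γ + 2 * γ ^ 2)) *
        ((N : ℝ) ^ (r - 1) + (N : ℝ) ^ (1 - q))) := by
  have hN2 : (2 : ℝ) ≤ N := by exact_mod_cast hN
  have hN0 : (0 : ℝ) < N := by linarith
  have hN1 : (1 : ℝ) ≤ N := by linarith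
  have hr2 : (N : ℝ) * (N : ℝ) ^ (r - 1) = (N : ℝ) ^ r := by
    rw [← Real.rpow_one_add' hN0.le (by linarith), add_sub_cancel]
  have hq2 : (N : ℝ) ^ (1 - q) * (N : ℝ) ^ q = N := by
    rw [← Real.rpow_add hN0, sub_add_cancel, Real.rpow_one]
  have hrN : (N : ℝ) ^ r ≤ N := by
    simpa using Real.rpow_le_rpow_of_exponent_le hN1 hr1
  have hr1' : 1 ≤ (N : ℝ) ^ r := Real.one_le_rpow hN1 hr.le
  have hqpos : 0 < (N : ℝ) ^ q := Real.rpow_pos_of_pos hN0 q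
  have hpos : 0 < (N : ℝ) ^ (1 - q) := Real.rpow_pos_of_pos hN0 _
  have hpos' : 0 < (N : ℝ) ^ (r - 1) := Real.rpow_pos_of_pos hN0 _
  rw [abs_lt] at hs hd
  refine excessRiskLE_of_sum_le hα hγ (by omega) (fun F hF => ?_) ?_
  · have hF' : ∀ k ∈ F, 1 ≤ k ∧ k ≤ d := fun k hk => by exact_mod_cast hF k hk
    refine (sum_twoLevel_le (T := N * ((8 * γ + 2 * γ ^ 2) * (N : ℝ) ^ (1 - q)))
      (by positivity) (by positivity) hF' fun hsd => ?_).trans ?_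
    · have hm : 0 < (d : ℝ) - s := by
        have : (s : ℝ) < d := by exact_mod_cast hsd
        linarith
      set m := (d : ℝ) - s with hmdef
      set x := N * γ * (1 / m) with hx
      have hx0 : 0 ≤ x := by positivity
      have hmx : m * x = N * γ := by rw [hx]; field_simp
      -- When N^q is comparable to N, the gap d - s may be tiny, but min(1, x)² ≤ x bounds the tail
      -- by Nγ. Otherwise N ≤ N^q/8 absorbs s and the rounding errors, so d - s ≥ N^q/2 and the
      -- quadratic bound applies.
      rcases le_or_gt (1 / 8) ((N : ℝ) ^ (1 - q)) with h8 | h8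
      · have h1 : min 1 x ^ 2 ≤ x := by
          rw [sq]
          calc _ ≤ 1 * x := mul_le_mul (min_le_left _ _) (min_le_right _ _)
                (le_min zero_le_one hx0) zero_le_one
            _ = x := one_mul x
        calc m * min 1 x ^ 2 ≤ m * x := by gcongr
          _ = N * (8 * γ * (1 / 8)) := by rw [hmx]; ring
          _ ≤ N * ((8 * γ + 2 * γ ^ 2) * (N : ℝ) ^ (1 - q)) := by
            gcongr
            nlinarith [sq_nonneg γ]
      · have h2 : (N : ℝ) ≤ 1 / 8 * (N : ℝ) ^ q := by
          calc (N : ℝ) = (N : ℝ) ^ (1 - q) * (N : ℝ) ^ q := hq2.symm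
            _ ≤ _ := by gcongr
        have h3 : (N : ℝ) ^ q / 2 ≤ m := by linarith
        have h4 : min 1 x ^ 2 ≤ x ^ 2 :=
          pow_le_pow_left₀ (le_min zero_le_one hx0) (min_le_right _ _) 2
        have h5 : (N : ℝ) ≤ 2 * (N : ℝ) ^ (1 - q) * m := by
          calc (N : ℝ) = 2 * (N : ℝ) ^ (1 - q) * ((N : ℝ) ^ q / 2) := by linarith
            _ ≤ _ := by gcongr
        calc m * min 1 x ^ 2 ≤ m * x ^ 2 := by gcongr
          _ = N * (γ ^ 2 * (N / m)) := by rw [hx]; field_simp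
          _ ≤ N * (γ ^ 2 * (2 * (N : ℝ) ^ (1 - q))) := by
            gcongr
            rwa [div_le_iff₀ hm]
          _ ≤ _ := by
            refine mul_le_mul_of_nonneg_left ?_ hN0.le
            nlinarith [mul_pos hγ hpos]
    · have h6 : 0 ≤ N * ((8 * γ + 2 * γ ^ 2) * (N : ℝ) ^ (r - 1)) := by positivity
      nlinarith [mul_pos hN0 hpos]
  · rw [one_mul, ← Real.rpow_neg_one]
    have := Real.rpow_le_rpow_of_exponent_le hN1 (by linarith : (-1 : ℝ) ≤ r - 1)
    linarith

/-- The cut is at x = N^(1/(1+r)), where Nλ_k is of order 1. Beyond it k^(-2(1+r)) ≤ K^(-2r)k⁻², so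
head and tail are both of order x = Nε. -/
lemma excessRiskLE_polynomial {α γ σsq ρ r : ℝ} (hα : 0 < α) (hγ : 0 < γ) (hr : 0 < r)
    {N : ℕ} (D : ℕ∞) (hN : 2 ≤ N) :
    ExcessRiskLE.{u, v} α γ σsq ρ N D (fun k => (k : ℝ) ^ (-(1 + r)))
      ((ρ ^ 2 / γ * 1 + 4 * |σsq| * (2 + γ ^ 2)) * (N : ℝ) ^ (-(r / (1 + r)))) := by
  have hN1 : (1 : ℝ) ≤ N := by exact_mod_cast (by omega : 1 ≤ N)
  have hN0 : (0 : ℝ) < N := by linarith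
  have hr1 : 0 < 1 + r := by linarith
  set x := (N : ℝ) ^ (1 + r)⁻¹ with hx
  have hx1 : 1 ≤ x := Real.one_le_rpow hN1 (by positivity)
  have hx0 : 0 < x := by linarith
  have hxN : x ^ (1 + r) = N := by
    rw [hx, ← Real.rpow_mul hN0.le, inv_mul_cancel₀ hr1.ne', Real.rpow_one]
  have hε : N * (N : ℝ) ^ (-(r / (1 + r))) = x := by
    have he : (1 + r)⁻¹ = 1 + -(r / (1 + r)) := by field_simp; ring
    rw [hx, he, Real.rpow_add hN0, Real.rpow_one]
  refine excessRiskLE_of_sum_le hα hγ (by omega) (fun F hF => ?_) ?_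
  · set K := ⌈x⌉₊ with hK
    have hxK : x ≤ K := Nat.le_ceil x
    have hKx : (K : ℝ) < x + 1 := Nat.ceil_lt_add_one hx0.le
    have hK0 : K ≠ 0 := (Nat.ceil_pos.2 hx0).ne'
    have hKpos : (0 : ℝ) < K := by positivity
    refine (sum_min_one_sq_le (K := K) (T := N ^ 2 * γ ^ 2 * (K : ℝ) ^ (-(2 * r)))
      (fun k hk => (hF k hk).1) (fun k _ => by positivity) hK0 (by positivity)
      fun k hk => ?_).trans ?_
    · have hKk : (K : ℝ) ≤ k := by exact_mod_cast hk.le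
      have hk0 : (0 : ℝ) < k := hKpos.trans_le hKk
      have h1 : ((k : ℝ) ^ (-(1 + r))) ^ 2 = (k : ℝ) ^ (-(2 * r)) * ((k : ℝ) ^ 2)⁻¹ := by
        rw [← Real.rpow_natCast, ← Real.rpow_natCast, ← Real.rpow_mul hk0.le,
          ← Real.rpow_neg hk0.le, ← Real.rpow_add hk0]
        congr 1
        push_cast
        ring
      rw [mul_pow, mul_pow, h1, ← mul_assoc]
      refine mul_le_mul_of_nonneg_right (mul_le_mul_of_nonneg_left ?_ (by positivity))
        (by positivity)
      exact Real.rpow_le_rpow_of_nonpos hKpos hKk (by linarith)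
    · have h2 : (N : ℝ) ^ 2 * γ ^ 2 * (K : ℝ) ^ (-(2 * r)) * (K : ℝ)⁻¹ ≤ γ ^ 2 * x := by
        calc _ ≤ (N : ℝ) ^ 2 * γ ^ 2 * x ^ (-(2 * r)) * x⁻¹ := by
              have := Real.rpow_le_rpow_of_nonpos hx0 hxK (by linarith : -(2 * r) ≤ 0)
              gcongr
          _ = γ ^ 2 * ((x ^ (1 + r)) ^ 2 * x ^ (-(2 * r)) * x⁻¹) := by rw [hxN]; ring
          _ = γ ^ 2 * x := by
              rw [← Real.rpow_natCast (x ^ (1 + r)), ← Real.rpow_mul hx0.le, ← Real.rpow_add hx0,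
                ← Real.rpow_neg_one, ← Real.rpow_add hx0]
              congr 1
              conv_rhs => rw [← Real.rpow_one x]
              congr 1
              push_cast
              ring
      calc _ ≤ 2 * x + γ ^ 2 * x := by linarith
        _ = _ := by rw [← hε]; ring
  · rw [one_mul, ← Real.rpow_neg_one]
    refine Real.rpow_le_rpow_of_exponent_le hN1 ?_
    rw [neg_le_neg_iff, div_le_one hr1]
    linarith

lemma log_rpow_le {β x : ℝ} (hβ : 0 < β) (hx : 1 ≤ x) :
    Real.log x ^ β ≤ (2 * β) ^ β * x ^ (1 / 2 : ℝ) := by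
  have hx0 : 0 ≤ x := by linarith
  have h := Real.log_le_rpow_div hx0 (by positivity : 0 < 1 / (2 * β))
  calc Real.log x ^ β ≤ (x ^ (1 / (2 * β)) / (1 / (2 * β))) ^ β :=
        Real.rpow_le_rpow (Real.log_nonneg hx) h hβ.le
    _ = _ := by
        rw [div_div_eq_mul_div, div_one, Real.mul_rpow (by positivity) (by positivity),
          ← Real.rpow_mul hx0, mul_comm]
        congr 2
        field_simp

lemma excessRiskLE_log {α γ σsq ρ β : ℝ} (hα : 0 < α) (hγ : 0 < γ) (hβ : 1 < β)
    {N : ℕ} (D : ℕ∞) (hN : 2 ≤ N) :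
    ExcessRiskLE.{u, v} α γ σsq ρ N D (fun k => (k : ℝ)⁻¹ * Real.log ((k : ℝ) + 1) ^ (-β))
      ((ρ ^ 2 / γ * (2 * β) ^ β + 4 * |σsq| * (1 + (2 * β) ^ β +
        γ ^ 2 * (2 * (2 * β) ^ β) ^ (2 * β))) * Real.log (N : ℝ) ^ (-β)) := by
  have hN1 : (1 : ℝ) < N := by exact_mod_cast (by omega : 1 < N)
  have hN0 : (0 : ℝ) < N := by linarith
  have hβ0 : 0 < β := by linarith
  set M := (2 * β) ^ β with hM
  have hM1 : 1 ≤ M := Real.one_le_rpow (by linarith) hβ0.le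
  have hM0 : 0 < M := by linarith
  set l := Real.log (N : ℝ) with hl
  have hl0 : 0 < l := Real.log_pos hN1
  have hlβ : 0 < l ^ β := Real.rpow_pos_of_pos hl0 β
  have hlM : l ^ β ≤ M * (N : ℝ) ^ (1 / 2 : ℝ) := log_rpow_le hβ0 hN1.le
  have hhalf : (N : ℝ) ^ (1 / 2 : ℝ) * (N : ℝ) ^ (1 / 2 : ℝ) = N := by
    rw [← Real.rpow_add hN0]
    norm_num
  have hhalf1 : 1 ≤ (N : ℝ) ^ (1 / 2 : ℝ) := Real.one_le_rpow hN1.le (by norm_num)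
  have hlMN : l ^ β ≤ M * N := hlM.trans (by
    gcongr
    nlinarith)
  have hinv : l ^ (-β) = (l ^ β)⁻¹ := Real.rpow_neg hl0.le β
  refine excessRiskLE_of_sum_le hα hγ (by omega) (fun F hF => ?_) ?_
  · set x := (N : ℝ) * l ^ (-β) with hx
    have hx0 : 0 < x := by positivity
    set K := ⌈x⌉₊ with hK
    have hxK : x ≤ K := Nat.le_ceil x
    have hKx : (K : ℝ) < x + 1 := Nat.ceil_lt_add_one hx0.le
    have hK0 : K ≠ 0 := (Nat.ceil_pos.2 hx0).ne'
    have hKpos : (0 : ℝ) < K := by positivity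
    -- The cut K ≈ N/log^β N is still polynomially large in N, so log(K + 1) is comparable to log N.
    -- Bernoulli's inequality absorbs the constant `M` into an exponent: √N ≤ Mx ≤ (1 + x)^M.
    have hlogK : l / (2 * M) ≤ Real.log ((K : ℝ) + 1) := by
      have h1 : (N : ℝ) ^ (1 / 2 : ℝ) ≤ M * x := by
        rw [hx, hinv, ← div_eq_mul_inv, ← mul_div_assoc, le_div_iff₀ hlβ]
        calc _ ≤ (N : ℝ) ^ (1 / 2 : ℝ) * (M * (N : ℝ) ^ (1 / 2 : ℝ)) := by gcongr
          _ = M * N := by rw [mul_left_comm, hhalf]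
      have h2 : (N : ℝ) ^ (1 / 2 : ℝ) ≤ (1 + x) ^ M := by
        have := one_add_mul_self_le_rpow_one_add (by linarith : -1 ≤ x) hM1
        linarith
      have h3 := Real.log_le_log (by positivity) h2
      rw [Real.log_rpow hN0, Real.log_rpow (by linarith)] at h3
      have h4 : Real.log (1 + x) ≤ Real.log ((K : ℝ) + 1) :=
        Real.log_le_log (by linarith) (by linarith)
      rw [div_le_iff₀ (by positivity)]
      nlinarith
    have hlogK0 : 0 < Real.log ((K : ℝ) + 1) := lt_of_lt_of_le (by positivity) hlogK
    refine (sum_min_one_sq_le (K := K) (T := N ^ 2 * γ ^ 2 * Real.log ((K : ℝ) + 1) ^ (-(2 * β)))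
      (fun k hk => (hF k hk).1) (fun k _ => ?_) hK0 (by positivity) fun k hk => ?_).trans ?_
    · have : 0 ≤ Real.log ((k : ℝ) + 1) := Real.log_nonneg (by linarith [k.cast_nonneg (α := ℝ)])
      positivity
    · have hKk : (K : ℝ) ≤ k := by exact_mod_cast hk.le
      have hlogle : Real.log ((K : ℝ) + 1) ≤ Real.log ((k : ℝ) + 1) :=
        Real.log_le_log (by linarith) (by linarith)
      have hlogk : 0 < Real.log ((k : ℝ) + 1) := hlogK0.trans_le hlogle
      have h1 : (Real.log ((k : ℝ) + 1) ^ (-β)) ^ 2 = Real.log ((k : ℝ) + 1) ^ (-(2 * β)) := by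
        rw [← Real.rpow_natCast, ← Real.rpow_mul hlogk.le]
        congr 1
        push_cast
        ring
      have h2 : Real.log ((k : ℝ) + 1) ^ (-(2 * β)) ≤ Real.log ((K : ℝ) + 1) ^ (-(2 * β)) :=
        Real.rpow_le_rpow_of_nonpos hlogK0 hlogle (by linarith)
      calc _ = N ^ 2 * γ ^ 2 * Real.log ((k : ℝ) + 1) ^ (-(2 * β)) * ((k : ℝ) ^ 2)⁻¹ := by
            rw [← h1]
            ring
        _ ≤ _ := by gcongr
    · have h2 : Real.log ((K : ℝ) + 1) ^ (-(2 * β)) ≤ (2 * M) ^ (2 * β) * (l ^ (-β)) ^ 2 := by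
        calc _ ≤ (l / (2 * M)) ^ (-(2 * β)) :=
              Real.rpow_le_rpow_of_nonpos (by positivity) hlogK (by linarith)
          _ = _ := by
              rw [Real.div_rpow hl0.le (by positivity), Real.rpow_neg (by positivity : 0 ≤ 2 * M),
                div_inv_eq_mul, mul_comm, ← Real.rpow_natCast (l ^ (-β)), ← Real.rpow_mul hl0.le]
              congr 2
              push_cast
              ring
      have h3 : (N : ℝ) ^ 2 * γ ^ 2 * Real.log ((K : ℝ) + 1) ^ (-(2 * β)) * (K : ℝ)⁻¹ ≤
          N * (γ ^ 2 * (2 * M) ^ (2 * β) * l ^ (-β)) := by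
        calc _ ≤ (N : ℝ) ^ 2 * γ ^ 2 * ((2 * M) ^ (2 * β) * (l ^ (-β)) ^ 2) * x⁻¹ := by gcongr
          _ = _ := by
              rw [hx]
              have : 0 < l ^ (-β) := by positivity
              field_simp
      -- Pays for the rounding in K < x + 1, since x itself may be below 1.
      have h4 : 1 ≤ M * x := by
        rw [hx, hinv, ← div_eq_mul_inv, ← mul_div_assoc, le_div_iff₀ hlβ]
        linarith
      calc _ ≤ x + M * x + N * (γ ^ 2 * (2 * M) ^ (2 * β) * l ^ (-β)) := by linarith
        _ = _ := by rw [hx]; ring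
  · rw [hinv, ← div_eq_mul_inv, le_div_iff₀ hlβ, ← div_eq_inv_mul, div_le_iff₀ hN0]
    exact hlMN

lemma excessRiskLE_exp {α γ σsq ρ : ℝ} (hα : 0 < α) (hγ : 0 < γ)
    {N : ℕ} (D : ℕ∞) (hN : 2 ≤ N) :
    ExcessRiskLE.{u, v} α γ σsq ρ N D (fun k => Real.exp (-(k : ℝ)))
      ((ρ ^ 2 / γ * 2 + 4 * |σsq| * (3 * (1 + γ ^ 2))) * (Real.log (N : ℝ) / N)) := by
  have hN2 : (2 : ℝ) ≤ N := by exact_mod_cast hN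
  have hN0 : (0 : ℝ) < N := by linarith
  set l := Real.log (N : ℝ) with hl
  -- Here log 2 > 1/2 enters; it gives both the constant 2 for the bias and K < l + 1 ≤ 3l.
  have hl1 : 1 ≤ 2 * l := by
    have h1 := Real.log_le_log (by norm_num) hN2
    have h2 := Real.log_two_gt_d9
    linarith
  have hl0 : 0 < l := by linarith
  refine excessRiskLE_of_sum_le hα hγ (by omega) (fun F hF => ?_) ?_
  · set K := ⌈l⌉₊ with hK
    have hlK : l ≤ K := Nat.le_ceil l
    have hKl : (K : ℝ) < l + 1 := Nat.ceil_lt_add_one hl0.le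
    have hK0 : K ≠ 0 := (Nat.ceil_pos.2 hl0).ne'
    have hKpos : (0 : ℝ) < K := by positivity
    have hNK : N * Real.exp (-(K : ℝ)) ≤ 1 := by
      calc N * Real.exp (-(K : ℝ)) ≤ N * Real.exp (-l) := by gcongr
        _ = 1 := by rw [Real.exp_neg, hl, Real.exp_log hN0, mul_inv_cancel₀ hN0.ne']
    refine (sum_min_one_sq_le (K := K) (T := γ ^ 2 * (K : ℝ) ^ 2)
      (fun k hk => (hF k hk).1) (fun k _ => by positivity) hK0 (by positivity)
      fun k hk => ?_).trans ?_
    · have hK1 : (1 : ℝ) ≤ K := by exact_mod_cast Nat.one_le_iff_ne_zero.2 hK0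
      have hKk : (K : ℝ) ≤ k := by exact_mod_cast hk.le
      have hk0 : (0 : ℝ) < k := hKpos.trans_le hKk
      -- Past K ≥ 1 the function ke⁻ᵏ stays below its value at K. With Ne⁻ᴷ ≤ 1 this gives Ne⁻ᵏ ≤
      -- K/k, hence T = γ²K².
      have h1 : (k : ℝ) ≤ K * Real.exp ((k : ℝ) - K) := by
        have h2 := Real.add_one_le_exp ((k : ℝ) - K)
        nlinarith [mul_le_mul_of_nonneg_left h2 hKpos.le,
          mul_nonneg (sub_nonneg.2 hK1) (sub_nonneg.2 hKk)]
      have h3 : N * Real.exp (-(k : ℝ)) * k ≤ K := by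
        calc _ ≤ N * Real.exp (-(k : ℝ)) * (K * Real.exp ((k : ℝ) - K)) := by gcongr
          _ = (N * Real.exp (-(K : ℝ))) * K := by
              rw [sub_eq_add_neg, Real.exp_add, Real.exp_neg (k : ℝ)]
              field_simp
          _ ≤ 1 * K := by gcongr
          _ = K := one_mul _
      rw [← div_eq_mul_inv, le_div_iff₀ (by positivity)]
      calc _ = γ ^ 2 * (N * Real.exp (-(k : ℝ)) * k) ^ 2 := by ring
        _ ≤ _ := by gcongr
    · calc (K : ℝ) + γ ^ 2 * (K : ℝ) ^ 2 * (K : ℝ)⁻¹ = K * (1 + γ ^ 2) := by field_simp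
        _ ≤ (3 * l) * (1 + γ ^ 2) := by
            gcongr
            linarith
        _ = _ := by field_simp
  · rw [← mul_div_assoc, ← one_div]
    gcongr

end Spectra

end BenignSGD

end

theorem corollary2p3 (α γ σsq ρ : ℝ) (hα : 0 < α) (hγ : 0 < γ) :
    (∀ r q : ℝ, 0 < r → r ≤ 1 → 1 ≤ q →
      ∃ C : ℝ, ∀ N s d : ℕ, 2 ≤ N →
        |(s : ℝ) - (N : ℝ) ^ r| < 1 → |(d : ℝ) - (N : ℝ) ^ q| < 1 →
        BenignSGD.ExcessRiskLE.{u, v} α γ σsq ρ N d (BenignSGD.twoLevel s d)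
          (C * ((N : ℝ) ^ (r - 1) + (N : ℝ) ^ (1 - q)))) ∧
    (∀ r : ℝ, 0 < r →
      ∃ C : ℝ, ∀ (N : ℕ) (D : ℕ∞), 2 ≤ N →
        BenignSGD.ExcessRiskLE.{u, v} α γ σsq ρ N D (fun k => (k : ℝ) ^ (-(1 + r)))
          (C * (N : ℝ) ^ (-(r / (1 + r))))) ∧
    (∀ β : ℝ, 1 < β →
      ∃ C : ℝ, ∀ (N : ℕ) (D : ℕ∞), 2 ≤ N →
        BenignSGD.ExcessRiskLE.{u, v} α γ σsq ρ N D
          (fun k => (k : ℝ)⁻¹ * Real.log ((k : ℝ) + 1) ^ (-β))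
          (C * Real.log (N : ℝ) ^ (-β))) ∧
    (∃ C : ℝ, ∀ (N : ℕ) (D : ℕ∞), 2 ≤ N →
        BenignSGD.ExcessRiskLE.{u, v} α γ σsq ρ N D (fun k => Real.exp (-(k : ℝ)))
          (C * (Real.log (N : ℝ) / (N : ℝ)))) :=
  ⟨fun _ _ hr hr1 _ => ⟨_, fun _ _ _ hN hs hd =>
      BenignSGD.excessRiskLE_twoLevel hα hγ hr hr1 hN hs hd⟩,
    fun _ hr => ⟨_, fun _ D hN => BenignSGD.excessRiskLE_polynomial hα hγ hr D hN⟩,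
    fun _ hβ => ⟨_, fun _ D hN => BenignSGD.excessRiskLE_log hα hγ hβ D hN⟩,
    ⟨_, fun _ D hN => BenignSGD.excessRiskLE_exp hα hγ D hN⟩⟩
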